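/- **Setting.** Let $\mathcal S,\mathcal A$ be finite sets. A semi-infinitely constrained MDP (SICMDP) is a tuple $M=\langle\mathcal S,\mathcal A,Y,P,r,c,u,\mu,\gamma\rangle$ with a transition kernel $P(s'|s,a)$, a reward $r:\mathcal S\times\mathcal A\to[0,1]$, a compact index set $Y\subset\mathbb R^m$, costs $c_y:\mathcal S\times\mathcal A\to[0,1]$ and bounds $u_y\in\mathbb R$ ($y\in Y$), an initial distribution $\mu$ and a discount factor $\gamma\in[0,1)$. For a stationary policy $\pi$ and $f:\mathcal S\times\mathcal A\to\mathbb R$ put $V^{\pi,P}_f(\mu)=\mathbb E\big[\sum_{t\ge0}\gamma^t f(s_t,a_t)\big]$, where $s_0\sim\mu$, $a_t\sim\pi(\cdot|s_t)$, $s_{t+1}\sim P(\cdot|s_t,a_t)$. Assume that the problem $\max_\pi V_r^{\pi,P}(\mu)$ subject to $V^{\pi,P}_{c_y}(\mu)\le u_y$ for all $y\in Y$ has an optimal solution $\pi^*$. Only $P$ is unknown to the learner. The dataset comes from a generative model: for every pair $(s,a)$ it contains $n_0$ independent samples from $P(\cdot|s,a)$, independent across pairs, hence $n=|\mathcal S||\mathcal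 A|n_0$ samples in all. **Optimistic set.** Given counts $n(s,a,s')$ with $n(s,a)=\sum_{s'}n(s,a,s')$, let $\hat P(s'|s,a)=n(s,a,s')/\max\{1,n(s,a)\}$ and $$d_{\delta}(s,a,s')=\min\Big\{\sqrt{\tfrac{2\hat P(s'|s,a)(1-\hat P(s'|s,a))\log(4/\delta)}{n(s,a,s')}}+\tfrac{4\log(4/\delta)}{n(s,a,s')},\ \sqrt{\tfrac{\log(2/\delta)}{2n(s,a,s')}}\Big\},$$ read as $+\infty$ if $n(s,a,s')=0$. The optimistic set $M_\delta$ consists of the SICMDPs that differ from $M$ only in their kernel $P'$, where $|P'(s'|s,a)-\hat P(s'|s,a)|\le d_\delta(s,a,s')$ for all $s,a,s'$, and $P'(s'|s,a)=0$ whenever $s'$ is known not to be a possible successor of $(s,a)$. The optimistic planning problem is to maximize $V_r^{\pi,P'}(\mu)$ over all $P'$ in the optimistic set and all stationary policies $\pi$ with $V_{c_y}^{\pi,P'}(\mu)\le u_y$ for all $y\in Y$. **Modified SI-CRL.** Let $d=\max\{1,\lceil\log_2|\mathcal S|\rceil\}$ and number the states $0,\dots,|\mathcal S|-1$ in any way.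 For every pair $(s,a)$ take a binary tree of depth $d$ whose leaves are the states of $\mathcal S$: at depth $j$ the leaf with number $i$ has the ancestor with index $\lfloor i/2^{d-j}\rfloor$, and only vertices with a leaf below them are kept. The augmented state space $\bar{\mathcal S}$ consists of $\mathcal S$ and of the inner vertices other than the root of all these trees; the state $s$, with action $a$ played, serves as the root of the tree of $(s,a)$. The possible successors of $(s,a)$ and of an inner vertex (whatever action is played there) are its at most two children. Rewards and costs are $0$ at inner vertices, $\mu$ is extended by $0$, $Y$ and $u$ are unchanged, and $\bar\gamma=\gamma^{1/d}$. Every sample $(s,a,s')$ is replaced by the $d$ steps of the path from the root to the leaf $s'$ in the tree of $(s,a)$; a step that starts in an inner vertex is counted for every action. The modified SI-CRL solves the optimistic planning problem of this augmented problem, with these counts, with the known tree successors, and with confidence parameter $\delta/(2|\mathcal S|^4|\mathcal A|^3)$, exactly (it finds some optimal solution $(P',\tilde\pi)$ whenever there is one), and returns the restriction $\hat\pi$ of $\tilde\pi$ to $\mathcal S$. When there is no optimal solution it may return any policy. **Theorem.** There is a universal constant $C>0$ such that the following holds for every such SICMDP, all $\varepsilon,\delta>0$, every numbering of the states and every exact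 solver of the optimistic planning problem. If the number of samples $n=|\mathcal S||\mathcal A|n_0$ from the generative model satisfies $$n\ \ge\ C\,\frac{|\mathcal S|^2|\mathcal A|^2(\log|\mathcal S|)^3\log\!\big(8|\mathcal S|^4|\mathcal A|^3/\delta\big)}{\varepsilon^2(1-\gamma)^3},$$ then the modified SI-CRL is $(\varepsilon,\delta)$-optimal: with probability at least $1-\delta$ the policy $\hat\pi$ that it returns satisfies $$V_r^{\pi^*,P}(\mu)-V_r^{\hat\pi,P}(\mu)\le\varepsilon\qquad\text{and}\qquad V_{c_y}^{\hat\pi,P}(\mu)-u_y\le\varepsilon\quad\text{for all }y\in Y.$$ -/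

import Mathlib

open Set

/-- A transition kernel: `P s a s'` is the probability of moving to `s'` when action `a` is
played at state `s`. -/
abbrev TransitionKernel (S A : Type*) [Fintype S] := S → A → stdSimplex ℝ S

/-- A stationary policy: `π s a` is the probability of playing `a` at state `s`. -/
abbrev StationaryPolicy (S A : Type*) [Fintype A] := S → stdSimplex ℝ A

/-- A semi-infinitely constrained MDP without its transition dynamics, i.e. the tuple
`⟨S, A, Y, r, c, u, μ, γ⟩`.  This is exactly the part that is known to the learner; an SICMDP is a
pair `(M, P)` with `M : SICMDP S A m` and `P : TransitionKernel S A`. The norm of `Fin m → ℝ`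
is the sup norm. -/
structure SICMDP (S A : Type*) [Fintype S] [Fintype A] (m : ℕ) where
  /-- the index set of the constraints -/
  Y : Set (Fin m → ℝ)
  isCompact_Y : IsCompact Y
  /-- the reward -/
  r : S → A → ℝ
  r_mem : ∀ s a, r s a ∈ Icc (0 : ℝ) 1
  /-- the cost functions -/
  c : Y → S → A → ℝ
  c_mem : ∀ y s a, c y s a ∈ Icc (0 : ℝ) 1
  /-- the values for the constraints -/
  u : Y → ℝ
  /-- the initial distribution -/
  μ : stdSimplex ℝ S
  /-- the discount factor -/
  γ : ℝ
  γ_nonneg : 0 ≤ γ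
  γ_lt_one : γ < 1

namespace SICMDP

noncomputable section

section Model

variable {S A : Type*} [Fintype S] [Fintype A] {m : ℕ}

/-- `stateProb M P π t s` is the probability that `s_t = s` when `s_0` has law `μ`, the actions are
drawn from `π` and the transitions from `P`. -/
def stateProb (M : SICMDP S A m) (P : TransitionKernel S A) (π : StationaryPolicy S A) :
    ℕ → S → ℝ
  | 0, s => M.μ s
  | t + 1, s' => ∑ s, ∑ a, stateProb M P π t s * π s a * P s a s'

/-- The value `V_f^π(μ) = E (∑ₜ γ^t f(s_t, a_t))` of the policy `π` for the function `f`
(the reward or one of the costs) when the transitions follow `P`. -/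
def value (M : SICMDP S A m) (P : TransitionKernel S A) (π : StationaryPolicy S A)
    (f : S → A → ℝ) : ℝ :=
  ∑' t : ℕ, M.γ ^ t * ∑ s, ∑ a, M.stateProb P π t s * π s a * f s a

/-- The policy `π` satisfies all constraints `V_{c_y}^π(μ) ≤ u_y`, `y ∈ Y`. -/
def Feasible (M : SICMDP S A m) (P : TransitionKernel S A) (π : StationaryPolicy S A) : Prop :=
  ∀ y : M.Y, M.value P π (M.c y) ≤ M.u y

/-- `π` is an optimal solution of the problem `max_π V_r^π(μ)` s.t. `V_{c_y}^π(μ) ≤ u_y` for all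
`y ∈ Y`, in the SICMDP with dynamics `P`. -/
def IsOptimalPolicy (M : SICMDP S A m) (P : TransitionKernel S A)
    (π : StationaryPolicy S A) : Prop :=
  M.Feasible P π ∧ ∀ π', M.Feasible P π' → M.value P π' M.r ≤ M.value P π M.r

/-- The pair `(P', π)` is an exact solution of the optimistic planning problem: maximize
`V_r^{π, P'}(μ)` over all `P'` in the optimistic set `K` and all policies `π` such that
`V_{c_y}^{π, P'}(μ) ≤ u_y` for all `y ∈ Y`. -/
def IsOptimisticSolution (M : SICMDP S A m) (K : Set (TransitionKernel S A))
    (z : TransitionKernel S A × StationaryPolicy S A) : Prop :=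
  z.1 ∈ K ∧ M.Feasible z.1 z.2 ∧
    ∀ P' ∈ K, ∀ π', M.Feasible P' π' → M.value P' π' M.r ≤ M.value z.1 z.2 M.r

end Model

section OptimisticSet

variable {S A : Type*} [Fintype S] [Fintype A]

/-- The empirical estimate of the dynamics from the transition counts `N s a s' = n(s,a,s')`. -/
def empirical (N : S → A → S → ℕ) (s : S) (a : A) (s' : S) : ℝ :=
  (N s a s' : ℝ) / max 1 (∑ x, (N s a x : ℝ))

/-- The confidence radius `d_δ(s,a,s')`, used for `n(s,a,s') ≠ 0`. -/
def radius (N : S → A → S → ℕ) (δ : ℝ) (s : S) (a : A) (s' : S) : ℝ :=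
  min
    (√(2 * empirical N s a s' * (1 - empirical N s a s') * Real.log (4 / δ) / N s a s')
      + 4 * Real.log (4 / δ) / N s a s')
    (√(Real.log (2 / δ) / (2 * N s a s')))

/-- The optimistic set (the dynamics of the SICMDPs in `M_δ`), when it is known that a transition
from `s` under `a` can only lead to a state in `supp s a`. A triple with `n(s,a,s') = 0` has
the radius `a / 0 = +∞` and therefore gives no constraint. -/
def optimisticSet (supp : S → A → Set S) (N : S → A → S → ℕ) (δ : ℝ) :
    Set (TransitionKernel S A) :=
  {P' | (∀ s a s', s' ∉ supp s a → P' s a s' = 0) ∧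
    ∀ s a s', N s a s' ≠ 0 → |P' s a s' - empirical N s a s'| ≤ radius N δ s a s'}

end OptimisticSet

section GenerativeModel

variable {S A : Type*} [Fintype S] [Fintype A]

/-- A dataset with `n₀` recorded successors of every state-action pair. -/
abbrev Dataset (S A : Type*) (n₀ : ℕ) := S → A → Fin n₀ → S

/-- The probability of the event `E` when the dataset is generated by a generative model with
dynamics `P`: all entries are independent, and the entries `D s a i` have the law `P s a`. -/
def generativeProb [DecidableEq S] [DecidableEq A] (P : TransitionKernel S A) (n₀ : ℕ)
    (E : Set (Dataset S A n₀)) : ℝ :=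
  ∑ D : Dataset S A n₀, E.indicator (fun D => ∏ s, ∏ a, ∏ i, P s a (D s a i)) D

/-- A learning algorithm, which maps datasets to policies, is `(ε, δ)`-optimal on `(M, P)` with
`n₀` samples per pair: with probability at least `1 - δ` it returns a policy that is
`ε`-suboptimal in reward (against the optimal policy `πstar`) and that violates every constraint by
at most `ε`. -/
def IsEpsDeltaOptimal [DecidableEq S] [DecidableEq A] {m : ℕ} (M : SICMDP S A m)
    (P : TransitionKernel S A) (πstar : StationaryPolicy S A) (n₀ : ℕ)
    (alg : Dataset S A n₀ → StationaryPolicy S A) (ε δ : ℝ) : Prop :=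
  1 - δ ≤ generativeProb P n₀
    {D | M.value P πstar M.r - M.value P (alg D) M.r ≤ ε ∧
      ∀ y : M.Y, M.value P (alg D) (M.c y) - M.u y ≤ ε}

end GenerativeModel

/-! ### The binary-tree augmentation -/

section Augmentation

variable {S A : Type*} [Fintype S] [Fintype A] {m : ℕ}

/-- The depth of the binary trees: `⌈log₂ |S|⌉`, but at least `1`. -/
def treeDepth (S : Type*) [Fintype S] : ℕ := max 1 (Nat.clog 2 (Fintype.card S))

/-- The inner nodes other than the root of the binary tree of depth `d = treeDepth S` whose leaves,
numbered `0, …, |S| - 1`, are the states of `S`: the node `(j, k)` is the `k`-th node at depth `j`,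
below which lie the leaves with the numbers `k * 2 ^ (d - j), …, (k + 1) * 2 ^ (d - j) - 1`
(only nodes with at least one leaf below them are kept). -/
abbrev TreeNode (S : Type*) [Fintype S] :=
  {q : Fin (treeDepth S) × Fin (Fintype.card S) //
    0 < (q.1 : ℕ) ∧ (q.2 : ℕ) * 2 ^ (treeDepth S - q.1) < Fintype.card S}

/-- The augmented state space: the original states, and for every pair `(s, a)` the inner nodes of
its own tree, whose root is the original state `s` (when `a` is played there). -/
abbrev AugState (S A : Type*) [Fintype S] := S ⊕ (S × A × TreeNode S)

/-- The index of the ancestor at depth `j` of the leaf `s'`. -/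
def ancestor (e : S ≃ Fin (Fintype.card S)) (j : ℕ) (s' : S) : ℕ :=
  (e s' : ℕ) / 2 ^ (treeDepth S - j)

theorem ancestor_mul_lt (e : S ≃ Fin (Fintype.card S)) (j : ℕ) (s' : S) :
    ancestor e j s' * 2 ^ (treeDepth S - j) < Fintype.card S :=
  lt_of_le_of_lt (Nat.div_mul_le_self _ _) (e s').2

theorem ancestor_lt (e : S ≃ Fin (Fintype.card S)) (j : ℕ) (s' : S) :
    ancestor e j s' < Fintype.card S :=
  lt_of_le_of_lt (Nat.div_le_self _ _) (e s').2

/-- The vertex at depth `j ≥ 1` on the way from the root to the leaf `s'` in the tree of `(s, a)`: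
a tree node for `j < d`, and the original state `s'` at depth `d`. -/
def pathVertex (e : S ≃ Fin (Fintype.card S)) (s : S) (a : A) (s' : S) (j : ℕ) : AugState S A :=
  if h : 0 < j ∧ j < treeDepth S then
    Sum.inr (s, a, ⟨(⟨j, h.2⟩, ⟨ancestor e j s', ancestor_lt e j s'⟩),
      h.1, ancestor_mul_lt e j s'⟩)
  else Sum.inl s'

/-- `AugStep e x b s a s' x'`: if the original transition `(s, a, s')` is carried out as a
walk through the tree of `(s, a)`, then this walk passes through `x` and its next state is `x'`.
At an original state the action `b` has to be `a`; at a tree node actions have no effect. -/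
def AugStep (e : S ≃ Fin (Fintype.card S)) (x : AugState S A) (b : A) (s : S) (a : A) (s' : S)
    (x' : AugState S A) : Prop :=
  match x with
  | Sum.inl t => t = s ∧ b = a ∧ x' = pathVertex e s a s' 1
  | Sum.inr (t, b', q) => t = s ∧ b' = a ∧ ancestor e q.1.1 s' = (q.1.2 : ℕ) ∧
      x' = pathVertex e s a s' (q.1.1 + 1)

/-- The possible successors in the augmented state space (at most two: the children in the tree). -/
def augSupp (e : S ≃ Fin (Fintype.card S)) (x : AugState S A) (b : A) : Set (AugState S A) :=
  {x' | ∃ s a s', AugStep e x b s a s' x'}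

/-- The counts `n(x,b,x')` in the augmented dataset, in which every recorded transition is replaced
by the steps of its walk through the tree (a step that starts in a tree node is recorded for
every action `b`, since actions have no effect there). -/
def augCount (e : S ≃ Fin (Fintype.card S)) {n₀ : ℕ} (D : Dataset S A n₀)
    (x : AugState S A) (b : A) (x' : AugState S A) : ℕ :=
  Nat.card {p : S × A × Fin n₀ // AugStep e x b p.1 p.2.1 (D p.1 p.2.1 p.2.2) x'}

/-- The augmented SICMDP: rewards and costs vanish at the tree nodes, the initial law lives on
the original states, and the discount factor is `γ ^ (1 / d)`, since `d` steps are needed for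
one original transition. -/
def augment (M : SICMDP S A m) : SICMDP (AugState S A) A m where
  Y := M.Y
  isCompact_Y := M.isCompact_Y
  r x a := Sum.elim (fun s => M.r s a) (fun _ => 0) x
  r_mem x a := by
    rcases x with s | q
    · exact M.r_mem s a
    · simp
  c y x a := Sum.elim (fun s => M.c y s a) (fun _ => 0) x
  c_mem y x a := by
    rcases x with s | q
    · exact M.c_mem y s a
    · simp
  u := M.u
  μ := ⟨Sum.elim (fun s => M.μ s) (fun _ => 0), by
    refine ⟨fun x => ?_, ?_⟩
    · rcases x with s | q
      · exact M.μ.2.1 s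
      · simp
    · rw [Fintype.sum_sum_type]
      simp⟩
  γ := M.γ ^ (1 / (treeDepth S : ℝ))
  γ_nonneg := Real.rpow_nonneg M.γ_nonneg _
  γ_lt_one := by
    refine Real.rpow_lt_one M.γ_nonneg M.γ_lt_one (one_div_pos.mpr ?_)
    exact_mod_cast lt_of_lt_of_le Nat.one_pos (le_max_left _ _)

end Augmentation

section ModifiedAlgorithm

variable {S A : Type*} [Fintype S] [Fintype A] {m : ℕ}

/-- The optimistic set of the augmented problem for the dataset `D`: the tree structure is known,
and the confidence parameter is `δ / (2 |S|⁴ |A|³)`. -/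
def augOptimisticSet (e : S ≃ Fin (Fintype.card S)) (δ : ℝ) {n₀ : ℕ} (D : Dataset S A n₀) :
    Set (TransitionKernel (AugState S A) A) :=
  optimisticSet (augSupp e) (augCount e D)
    (δ / (2 * (Fintype.card S : ℝ) ^ 4 * (Fintype.card A : ℝ) ^ 3))

/-- `solve` solves the optimistic planning problems of the augmented SICMDP exactly: for each
dataset for which the problem has an optimal solution, it returns one (nothing is required
of the output for other datasets). -/
def SolvesExactly (M : SICMDP S A m) (e : S ≃ Fin (Fintype.card S)) (δ : ℝ) (n₀ : ℕ)
    (solve : Dataset S A n₀ →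
      TransitionKernel (AugState S A) A × StationaryPolicy (AugState S A) A) : Prop :=
  ∀ D, (∃ z, M.augment.IsOptimisticSolution (augOptimisticSet e δ D) z) →
    M.augment.IsOptimisticSolution (augOptimisticSet e δ D) (solve D)

/-- The modified SI-CRL algorithm: solve the optimistic planning problem of the augmented SICMDP and
return the restriction of the resulting policy to the original states. -/
def modifiedSICRL {n₀ : ℕ}
    (solve : Dataset S A n₀ →
      TransitionKernel (AugState S A) A × StationaryPolicy (AugState S A) A)
    (D : Dataset S A n₀) : StationaryPolicy S A :=
  fun s => (solve D).2 (Sum.inl s)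

end ModifiedAlgorithm

end

end SICMDP

/-!
The learner plans in the augmented problem, in which every vertex has at most two successors.  Let
`Q` be the true dynamics of that problem, `d` the depth of the trees and `L = log (4 / δ')` with the
confidence parameter `δ'` of the optimistic set.

*Concentration.*  Given the number of samples that reach a vertex, the number of those that go on
to a fixed child is binomial (`iidExp_hits_pow`), so Chernoff's method applies conditionally on the
former (`iidProb_chernoff`).  It gives the inequalities of Bernstein and Hoeffding for each vertex,
and together they put `Q` into the optimistic set (`mem_optimisticSet_of_goodCounts`).  Conversely,
each kernel `P'` of the optimistic set deviates from `Q`, at a vertex with transition probabilities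
`p` and `1 - p`, by at most `4 √(p (1 - p) ρ) + 11 ρ`, where `ρ = 2 L / (n₀ R)` and `R` is the
probability that a transition from the root passes through the vertex
(`abs_sub_le_of_goodCounts`).  The radius of a rare child is large, since it involves the count of
this child, but the two deviations coincide, so that of the frequent child bounds both.

*Values.*  Let `ω` be the occupancy measure of the state-action pairs under `Q` and `v` the value
function under `P'`.  The two values of a policy differ by at most `X = Σ ω |γ (P' - Q) v|`, and by
the concentration bounds and the Cauchy-Schwarz inequality,
`X ≤ 4 √(γ² (Σ ω Var_Q v) (Σ ω ρ)) + 11 B Σ ω ρ` with `B = 1 / (1 - γ)` for the discount factor `γ`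
of the augmented problem.  The total variance satisfies `γ² Σ ω Var_Q v ≤ 2 B² + 2 B X`
(`sum_nextVar_le`).  Since `X` itself accounts for the mismatch of `Q` and `v`, the resulting
inequality bounds `X` for all `ε`, and no a priori bound of the value difference is needed
(`abs_value_sub_le`).

*Rates.*  The occupancy measure of the augmented problem is explicit (`isFlow_augFlow`): an inner
vertex is visited at most `R` times as often as the root of its tree.  As a tree has fewer than
`2 |S|` inner vertices, `Σ ω ρ` is at most `4 |S| L / n₀` times the original horizon
(`sum_augFlow_div_reach_le`), and `B` is at most `d` times the original horizon.

Therefore the optimal policy stays feasible, the planner reports at least its value, and the reward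
and the costs of the policy that is found are estimated with an error of at most `ε`.
-/

namespace SICMDP

/-! ### Moment generating functions of Bernoulli variables -/

theorem exp_le_one_add_of_abs_le {x l : ℝ} (hl : l ≤ 1) (hx : |x| ≤ l) :
    Real.exp x ≤ 1 + x + x ^ 2 / 2 * (1 + l / 2) := by
  have h := Real.exp_bound (hx.trans hl) (n := 3) (by norm_num)
  have h' := (abs_le.mp h).2
  simp only [Finset.sum_range_succ, Finset.sum_range_zero, Nat.factorial] at h'
  norm_num at h'
  have h3 : |x| ^ 3 ≤ x ^ 2 * l := by
    rw [pow_succ, sq_abs]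
    exact mul_le_mul_of_nonneg_left hx (sq_nonneg x)
  have h4 : 0 ≤ x ^ 2 * l := le_trans (by positivity) h3
  nlinarith

/-- Bernstein's bound for the moment generating function of a Bernoulli variable. -/
theorem bernoulli_mgf_le_bernstein {q l : ℝ} (hq0 : 0 ≤ q) (hq1 : q ≤ 1) (hl0 : 0 ≤ l)
    (hl1 : l ≤ 1) :
    1 - q + q * Real.exp l ≤ Real.exp (l * q + q * (1 - q) * l ^ 2 / 2 * (1 + l / 2)) := by
  have h1 : Real.exp (l * (1 - q)) ≤
      1 + l * (1 - q) + (l * (1 - q)) ^ 2 / 2 * (1 + l / 2) :=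
    exp_le_one_add_of_abs_le hl1 (by rw [abs_of_nonneg (by nlinarith)]; nlinarith)
  have h2 : Real.exp (-(l * q)) ≤ 1 + -(l * q) + (-(l * q)) ^ 2 / 2 * (1 + l / 2) :=
    exp_le_one_add_of_abs_le hl1 (by rw [abs_neg, abs_of_nonneg (by positivity)]; nlinarith)
  have h3 : 1 - q + q * Real.exp l =
      Real.exp (l * q) * ((1 - q) * Real.exp (-(l * q)) + q * Real.exp (l * (1 - q))) := by
    rw [show l * (1 - q) = l + -(l * q) by ring, Real.exp_add, Real.exp_neg]
    field_simp
  rw [h3, Real.exp_add]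
  refine mul_le_mul_of_nonneg_left ?_ (Real.exp_pos _).le
  refine le_trans ?_ (Real.add_one_le_exp _)
  have h4 := mul_le_mul_of_nonneg_left h1 hq0
  have h5 := mul_le_mul_of_nonneg_left h2 (sub_nonneg.mpr hq1)
  calc _ ≤ (1 - q) * (1 + -(l * q) + (-(l * q)) ^ 2 / 2 * (1 + l / 2)) +
        q * (1 + l * (1 - q) + (l * (1 - q)) ^ 2 / 2 * (1 + l / 2)) := add_le_add h5 h4
    _ = _ := by ring

/-- Hoeffding's bound for the moment generating function of a Bernoulli variable. -/
theorem bernoulli_mgf_le_hoeffding {q : ℝ} (hq0 : 0 ≤ q) (hq1 : q ≤ 1) (l : ℝ) :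
    1 - q + q * Real.exp l ≤ Real.exp (l * q + l ^ 2 / 8) := by
  classical
  set μ : MeasureTheory.Measure ℝ := ENNReal.ofReal (1 - q) • MeasureTheory.Measure.dirac 0 +
    ENNReal.ofReal q • MeasureTheory.Measure.dirac 1 with hμ
  have hint : ∀ f : ℝ → ℝ, ∫ x, f x ∂μ = (1 - q) * f 0 + q * f 1 := by
    intro f
    rw [hμ, MeasureTheory.integral_add_measure, MeasureTheory.integral_smul_measure,
      MeasureTheory.integral_smul_measure, MeasureTheory.integral_dirac,
      MeasureTheory.integral_dirac, ENNReal.toReal_ofReal hq0,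
      ENNReal.toReal_ofReal (sub_nonneg.mpr hq1), smul_eq_mul, smul_eq_mul]
    · exact (MeasureTheory.integrable_dirac (by simp)).smul_measure (by simp)
    · exact (MeasureTheory.integrable_dirac (by simp)).smul_measure (by simp)
  have : MeasureTheory.IsProbabilityMeasure μ := by
    refine ⟨?_⟩
    simp only [hμ, MeasureTheory.Measure.coe_add, MeasureTheory.Measure.coe_smul, Pi.add_apply,
      Pi.smul_apply, MeasureTheory.measure_univ, smul_eq_mul, mul_one]
    rw [← ENNReal.ofReal_add (sub_nonneg.mpr hq1) hq0]
    simp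
  have hmem : ∀ᵐ x ∂μ, id x ∈ Icc (0 : ℝ) 1 := by
    rw [hμ, MeasureTheory.ae_add_measure_iff]
    constructor <;>
    · refine MeasureTheory.Measure.ae_smul_measure ?_ _
      rw [MeasureTheory.ae_dirac_iff (by exact measurableSet_Icc)]
      simp
  have h := (ProbabilityTheory.hasSubgaussianMGF_of_mem_Icc (μ := μ) aemeasurable_id hmem).mgf_le l
  rw [ProbabilityTheory.mgf, hint, hint] at h
  simp only [id, mul_zero, mul_one, zero_add, zero_sub, sub_zero, nnnorm_one] at h
  have h2 := mul_le_mul_of_nonneg_left h (Real.exp_pos (l * q)).le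
  rw [← Real.exp_add] at h2
  have e1 : Real.exp (l * q) * ((1 - q) * Real.exp (l * -q) + q * Real.exp (l * (1 - q))) =
      1 - q + q * Real.exp l := by
    rw [show l * (1 - q) = l + -(l * q) by ring, show l * -q = -(l * q) by ring, Real.exp_add,
      Real.exp_neg]
    field_simp
  rw [e1] at h2
  refine h2.trans (le_of_eq ?_)
  congr 2
  push_cast
  ring

/-! ### Counts in independent samples -/

section Hits

variable {S : Type*} [DecidableEq S]

/-- The number of samples in `H`. -/
def hits {n : ℕ} (H : Finset S) (ω : Fin n → S) : ℕ :=
  ∑ i, if ω i ∈ H then 1 else 0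

theorem hits_cons {n : ℕ} (H : Finset S) (s : S) (ω : Fin n → S) :
    hits H (Fin.cons s ω : Fin (n + 1) → S) = hits H ω + if s ∈ H then 1 else 0 := by
  rw [hits, Fin.sum_univ_succ, add_comm]
  rfl

theorem hits_le {n : ℕ} (H : Finset S) (ω : Fin n → S) : hits H ω ≤ n := by
  unfold hits
  calc _ ≤ ∑ _i : Fin n, 1 := Finset.sum_le_sum fun i _ => by split_ifs <;> simp
    _ = n := by simp

theorem hits_univ [Fintype S] {n : ℕ} (ω : Fin n → S) : hits Finset.univ ω = n := by simp [hits]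

theorem hits_sdiff {n : ℕ} {G H : Finset S} (hHG : H ⊆ G) (ω : Fin n → S) :
    hits (G \ H) ω + hits H ω = hits G ω := by
  unfold hits
  rw [← Finset.sum_add_distrib]
  refine Finset.sum_congr rfl fun i _ => ?_
  by_cases h : ω i ∈ H
  · simp [h, hHG h]
  · simp [h]

end Hits

section Iid

variable {S : Type*} [Fintype S]

/-- The expectation of `F` over `n` independent samples of the law `p`. -/
noncomputable def iidExp (p : S → ℝ) (n : ℕ) (F : (Fin n → S) → ℝ) : ℝ :=
  ∑ ω : Fin n → S, (∏ i, p (ω i)) * F ω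

theorem iidExp_succ (p : S → ℝ) (n : ℕ) (F : (Fin (n + 1) → S) → ℝ) :
    iidExp p (n + 1) F = ∑ s, p s * iidExp p n (fun ω => F (Fin.cons s ω)) := by
  unfold iidExp
  rw [← (Fin.consEquiv (fun _ : Fin (n + 1) => S)).sum_comp, Fintype.sum_prod_type]
  refine Finset.sum_congr rfl fun s _ => ?_
  rw [Finset.mul_sum]
  refine Finset.sum_congr rfl fun ω _ => ?_
  simp [Fin.consEquiv, Fin.prod_univ_succ, mul_assoc]

theorem iidExp_mono {p : S → ℝ} (hp : ∀ s, 0 ≤ p s) {n : ℕ} {F F' : (Fin n → S) → ℝ}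
    (h : ∀ ω, F ω ≤ F' ω) : iidExp p n F ≤ iidExp p n F' :=
  Finset.sum_le_sum fun ω _ =>
    mul_le_mul_of_nonneg_left (h ω) (Finset.prod_nonneg fun _ _ => hp _)

theorem iidExp_mul_left (p : S → ℝ) (n : ℕ) (c : ℝ) (F : (Fin n → S) → ℝ) :
    iidExp p n (fun ω => c * F ω) = c * iidExp p n F := by
  unfold iidExp
  rw [Finset.mul_sum]
  exact Finset.sum_congr rfl fun ω _ => by ring

theorem iidExp_sum {ι : Type*} (t : Finset ι) (p : S → ℝ) (n : ℕ)
    (F : ι → (Fin n → S) → ℝ) :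
    iidExp p n (fun ω => ∑ k ∈ t, F k ω) = ∑ k ∈ t, iidExp p n (F k) := by
  unfold iidExp
  rw [Finset.sum_comm]
  exact Finset.sum_congr rfl fun ω _ => by rw [Finset.mul_sum]

theorem iidExp_const {p : S → ℝ} (hp : ∑ s, p s = 1) (n : ℕ) (c : ℝ) :
    iidExp p n (fun _ => c) = c := by
  induction n with
  | zero => simp [iidExp]
  | succ n ih => rw [iidExp_succ]; simp [ih, ← Finset.sum_mul, hp]

open Classical in
/-- The probability of `E` under `n` independent samples of the law `p`. -/
noncomputable def iidProb (p : S → ℝ) (n : ℕ) (E : (Fin n → S) → Prop) : ℝ :=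
  iidExp p n (fun ω => if E ω then 1 else 0)

theorem iidProb_mono {p : S → ℝ} (hp : ∀ s, 0 ≤ p s) {n : ℕ}
    {E E' : (Fin n → S) → Prop} (h : ∀ ω, E ω → E' ω) : iidProb p n E ≤ iidProb p n E' := by
  classical
  refine iidExp_mono hp fun ω => ?_
  by_cases h1 : E ω
  · simp [h1, h ω h1]
  · simp only [h1, if_false]; split_ifs <;> norm_num

theorem iidProb_or_le {p : S → ℝ} (hp : ∀ s, 0 ≤ p s) {n : ℕ} (E E' : (Fin n → S) → Prop) :
    iidProb p n (fun ω => E ω ∨ E' ω) ≤ iidProb p n E + iidProb p n E' := by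
  classical
  unfold iidProb
  rw [iidExp, iidExp, iidExp, ← Finset.sum_add_distrib]
  refine Finset.sum_le_sum fun ω _ => ?_
  rw [← mul_add]
  refine mul_le_mul_of_nonneg_left ?_ (Finset.prod_nonneg fun _ _ => hp _)
  by_cases h : E ω <;> by_cases h' : E' ω <;> simp [h, h']

variable [DecidableEq S]

/-- Given the number of samples in `G`, the number of samples in `H ⊆ G` has a binomial law whose
success probability is the conditional probability `q` of `H`.  This is the corresponding identity
of (weighted) generating functions. -/
theorem iidExp_hits_pow {p : S → ℝ} {G H : Finset S} (hHG : H ⊆ G) {q : ℝ}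
    (hq : ∑ s ∈ H, p s = q * ∑ s ∈ G, p s) (θ : ℝ) (n : ℕ) (φ : ℕ → ℝ) :
    iidExp p n (fun ω => φ (hits G ω) * θ ^ hits H ω) =
      iidExp p n (fun ω => φ (hits G ω) * (1 - q + q * θ) ^ hits G ω) := by
  induction n generalizing φ with
  | zero => simp [iidExp, hits]
  | succ n ih =>
    set m := 1 - q + q * θ with hm
    set E1 := iidExp p n (fun ω => φ (hits G ω + 1) * m ^ hits G ω) with hE1
    set E0 := iidExp p n (fun ω => φ (hits G ω) * m ^ hits G ω) with hE0
    have key : ∑ s, p s * (if s ∈ G then (if s ∈ H then θ else 1) * E1 else E0) =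
        ∑ s, p s * (if s ∈ G then m * E1 else E0) := by
      have e1 : ∀ c : S → ℝ, ∑ s, p s * (if s ∈ G then c s * E1 else E0) =
          (∑ s ∈ G, p s * c s) * E1 + ∑ s, p s * (if s ∈ G then 0 else E0) := by
        intro c
        have e : ∀ s, p s * (if s ∈ G then c s * E1 else E0) =
            (if s ∈ G then p s * c s else 0) * E1 + p s * (if s ∈ G then 0 else E0) := by
          intro s
          split_ifs <;> ring
        simp_rw [e]
        rw [Finset.sum_add_distrib, ← Finset.sum_mul, Finset.sum_ite_mem, Finset.univ_inter]
      rw [e1, e1 (fun _ => m), ← Finset.sum_mul]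
      congr 2
      have e2 : ∑ s ∈ G, p s * (if s ∈ H then θ else 1) =
          ∑ s ∈ G, p s + (θ - 1) * ∑ s ∈ H, p s := by
        rw [← Finset.sum_sdiff hHG, ← Finset.sum_sdiff hHG (f := p),
          Finset.sum_congr rfl (g := p) (fun s hs => by
            rw [Finset.mem_sdiff] at hs; simp [hs.2]),
          Finset.sum_congr rfl (g := fun s => p s * θ) (s₂ := H) (fun s hs => by
            simp [hs]), ← Finset.sum_mul]
        ring
      rw [e2, hq, hm]
      ring
    rw [iidExp_succ, iidExp_succ]
    calc _ = ∑ s, p s * (if s ∈ G then (if s ∈ H then θ else 1) * E1 else E0) := by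
          refine Finset.sum_congr rfl fun s _ => ?_
          congr 1
          by_cases hG : s ∈ G
          · by_cases hH : s ∈ H
            · simp only [hits_cons, hG, hH, if_true]
              rw [hE1, ← ih (fun k => φ (k + 1)), ← iidExp_mul_left]
              congr 1; funext ω; ring
            · simp only [hits_cons, hG, hH, if_true, if_false, add_zero, one_mul]
              rw [hE1, ← ih (fun k => φ (k + 1))]
          · have hH : s ∉ H := fun h => hG (hHG h)
            simp only [hits_cons, hG, hH, if_false, add_zero]
            rw [hE0, ← ih φ]
      _ = _ := key
      _ = _ := by
          refine Finset.sum_congr rfl fun s _ => ?_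
          congr 1
          by_cases hG : s ∈ G
          · simp only [hits_cons, hG, if_true]
            rw [hE1, ← iidExp_mul_left]
            congr 1; funext ω; ring
          · simp only [hits_cons, hG, if_false, add_zero]
            rw [hE0]

/-- Chernoff's method, conditionally on the number of samples in `G`: both the base `θ` and the
prefactor `c` may depend on that number. -/
theorem iidProb_chernoff {p : S → ℝ} (hp0 : ∀ s, 0 ≤ p s) (hp1 : ∑ s, p s = 1) {G H : Finset S}
    (hHG : H ⊆ G) {q : ℝ} (hq : ∑ s ∈ H, p s = q * ∑ s ∈ G, p s) {n : ℕ}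
    {bad : ℕ → ℕ → Prop} {θ c : ℕ → ℝ} {β : ℝ} (hθ : ∀ m, 0 ≤ θ m) (hc : ∀ m, 0 ≤ c m)
    (hbad : ∀ m k, bad m k → 1 ≤ c m * θ m ^ k)
    (hβ : ∀ m, c m * (1 - q + q * θ m) ^ m ≤ β) :
    iidProb p n (fun ω => bad (hits G ω) (hits H ω)) ≤ β := by
  classical
  have hsplit : ∀ f : ℕ → ℕ → ℝ, iidExp p n (fun ω => f (hits G ω) (hits H ω)) =
      ∑ m ∈ Finset.range (n + 1), iidExp p n
        (fun ω => (if hits G ω = m then 1 else 0) * f m (hits H ω)) := by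
    intro f
    rw [← iidExp_sum]
    congr 1
    funext ω
    simp [hits_le]
  calc iidProb p n (fun ω => bad (hits G ω) (hits H ω))
      ≤ iidExp p n (fun ω => c (hits G ω) * θ (hits G ω) ^ hits H ω) := by
        refine iidExp_mono hp0 fun ω => ?_
        split_ifs with h
        · exact hbad _ _ h
        · exact mul_nonneg (hc _) (pow_nonneg (hθ _) _)
    _ = ∑ m ∈ Finset.range (n + 1), iidExp p n
        (fun ω => (if hits G ω = m then c m else 0) * θ m ^ hits H ω) := by
        rw [hsplit (fun m k => c m * θ m ^ k)]
        refine Finset.sum_congr rfl fun m _ => ?_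
        congr 1; funext ω; split_ifs <;> ring
    _ = ∑ m ∈ Finset.range (n + 1), iidExp p n
        (fun ω => (if hits G ω = m then c m else 0) * (1 - q + q * θ m) ^ hits G ω) := by
        refine Finset.sum_congr rfl fun m _ => ?_
        exact iidExp_hits_pow hHG hq (θ m) n (fun k => if k = m then c m else 0)
    _ ≤ ∑ m ∈ Finset.range (n + 1), iidExp p n
        (fun ω => (if hits G ω = m then 1 else 0) * β) := by
        refine Finset.sum_le_sum fun m _ => iidExp_mono hp0 fun ω => ?_
        split_ifs with h
        · rw [h, one_mul]; exact hβ m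
        · simp
    _ = iidExp p n (fun _ => β) := (hsplit (fun _ _ => β)).symm
    _ = β := iidExp_const hp1 n β

/-- Bernstein's inequality for the random number `hits G ω` of trials. -/
theorem iidProb_bernstein {p : S → ℝ} (hp0 : ∀ s, 0 ≤ p s) (hp1 : ∑ s, p s = 1)
    {G H : Finset S} (hHG : H ⊆ G) {q : ℝ} (hq : ∑ s ∈ H, p s = q * ∑ s ∈ G, p s)
    (hq0 : 0 ≤ q) (hq1 : q ≤ 1) {L : ℝ} (hL : 0 < L) (n : ℕ) :
    iidProb p n (fun ω => √(2 * (q * (1 - q)) * L * hits G ω) + L <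
      hits H ω - q * hits G ω) ≤ Real.exp (-L) := by
  -- the exponent `s / (σ + s)` with `s = √(2L)` and `σ` the standard deviation of the count
  set s := √(2 * L) with hs
  have hs2 : s ^ 2 = 2 * L := Real.sq_sqrt (by positivity)
  have hs0 : 0 < s := Real.sqrt_pos.mpr (by positivity)
  set σ : ℕ → ℝ := fun m => √(q * (1 - q) * m) with hσ
  have hσ0 : ∀ m, 0 ≤ σ m := fun m => Real.sqrt_nonneg _
  have hv0 : 0 ≤ q * (1 - q) := mul_nonneg hq0 (sub_nonneg.mpr hq1)
  have hσ2 : ∀ m : ℕ, σ m ^ 2 = q * (1 - q) * m := fun m => Real.sq_sqrt (by positivity)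
  have hσs : ∀ m : ℕ, √(2 * (q * (1 - q)) * L * m) = σ m * s := fun m => by
    rw [hσ, hs, ← Real.sqrt_mul (by positivity)]
    congr 1; ring
  set l : ℕ → ℝ := fun m => s / (σ m + s) with hl
  have hl0 : ∀ m, 0 ≤ l m := fun m => by have := hσ0 m; positivity
  have hl1 : ∀ m, l m ≤ 1 := fun m => by
    have := hσ0 m
    rw [hl]; simp only; rw [div_le_one (by positivity)]; linarith
  refine iidProb_chernoff hp0 hp1 hHG hq (θ := fun m => Real.exp (l m))
    (bad := fun m k => √(2 * (q * (1 - q)) * L * m) + L < k - q * m)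
    (c := fun m => Real.exp (-(l m * (q * m + (σ m * s + L)))))
    (fun m => (Real.exp_pos _).le) (fun m => (Real.exp_pos _).le) (fun m k h => ?_) (fun m => ?_)
  · rw [hσs] at h
    rw [← Real.exp_nat_mul, ← Real.exp_add]
    refine Real.one_le_exp ?_
    nlinarith [hl0 m]
  · have h1 := pow_le_pow_left₀ (by have := Real.exp_pos (l m); nlinarith)
      (bernoulli_mgf_le_bernstein hq0 hq1 (hl0 m) (hl1 m)) m
    refine (mul_le_mul_of_nonneg_left h1 (Real.exp_pos _).le).trans ?_
    rw [← Real.exp_nat_mul, ← Real.exp_add]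
    refine Real.exp_le_exp.mpr ?_
    have e1 : -(l m * (q * m + (σ m * s + L))) +
        m * (l m * q + q * (1 - q) * l m ^ 2 / 2 * (1 + l m / 2)) =
        -(l m * (σ m * s + s ^ 2 / 2)) + σ m ^ 2 * l m ^ 2 / 2 * (1 + l m / 2) := by
      rw [hσ2, hs2]; ring
    rw [e1, show L = s ^ 2 / 2 by linarith]
    have hls : l m * (σ m + s) = s := by
      rw [hl]; have := hσ0 m; simp only; field_simp
    have h2 : σ m * (1 + l m / 2) ≤ σ m + s := by
      have : σ m * l m ≤ s := by nlinarith [hl0 m, mul_nonneg (hl0 m) hs0.le]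
      nlinarith
    have h3 : σ m ^ 2 * l m ^ 2 / 2 * (1 + l m / 2) ≤ σ m * l m * s / 2 := by
      have h4 : 0 ≤ σ m * l m ^ 2 / 2 := by have := hσ0 m; positivity
      calc _ = σ m * l m ^ 2 / 2 * (σ m * (1 + l m / 2)) := by ring
        _ ≤ σ m * l m ^ 2 / 2 * (σ m + s) := mul_le_mul_of_nonneg_left h2 h4
        _ = σ m * l m / 2 * (l m * (σ m + s)) := by ring
        _ = _ := by rw [hls]; ring
    have h5 : l m * (σ m * s + s ^ 2 / 2) = σ m * l m * s / 2 + s ^ 2 / 2 := by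
      have : l m * (σ m * s + s ^ 2 / 2) =
        s / 2 * (l m * (σ m + s)) + σ m * l m * s / 2 := by ring
      rw [this, hls]; ring
    linarith

/-- Hoeffding's inequality for the random number `hits G ω` of trials. -/
theorem iidProb_hoeffding {p : S → ℝ} (hp0 : ∀ s, 0 ≤ p s) (hp1 : ∑ s, p s = 1)
    {G H : Finset S} (hHG : H ⊆ G) {q : ℝ} (hq : ∑ s ∈ H, p s = q * ∑ s ∈ G, p s)
    (hq0 : 0 ≤ q) (hq1 : q ≤ 1) {L : ℝ} (hL : 0 < L) (n : ℕ) :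
    iidProb p n (fun ω => √(L * hits G ω / 2) < hits H ω - q * hits G ω) ≤
      Real.exp (-L) := by
  -- the exponent `4t / m` for the deviation `t = √(Lm/2)` of `m` trials
  set t : ℕ → ℝ := fun m => √(L * m / 2) with ht
  have ht0 : ∀ m, 0 ≤ t m := fun m => Real.sqrt_nonneg _
  have ht2 : ∀ m : ℕ, t m ^ 2 = L * m / 2 := fun m => Real.sq_sqrt (by positivity)
  refine le_trans ?_ (iidProb_chernoff (n := n) hp0 hp1 hHG hq
    (θ := fun m => Real.exp (4 * t m / m))
    (bad := fun m k => k ≤ m ∧ √(L * m / 2) < k - q * m)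
    (c := fun m => if m = 0 then 0 else Real.exp (-(4 * t m / m * (q * m + t m))))
    (fun m => (Real.exp_pos _).le) (fun m => ?_) (fun m k h => ?_) (fun m => ?_))
  · refine iidExp_mono hp0 fun ω => ?_
    have hk : hits H ω ≤ hits G ω := by have := hits_sdiff hHG ω; omega
    simp only [hk, true_and]
    exact le_rfl
  · split_ifs
    · exact le_rfl
    · exact (Real.exp_pos _).le
  · rcases Nat.eq_zero_or_pos m with rfl | hm
    · exfalso
      have : k = 0 := by omega
      subst this
      simpa using h.2
    · rw [if_neg hm.ne', ← Real.exp_nat_mul, ← Real.exp_add]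
      refine Real.one_le_exp ?_
      have h0 : 0 ≤ 4 * t m / m := by have := ht0 m; positivity
      have := h.2
      nlinarith
  · rcases Nat.eq_zero_or_pos m with rfl | hm
    · simp [(Real.exp_pos _).le]
    · rw [if_neg hm.ne']
      have h1 := pow_le_pow_left₀ (by have := Real.exp_pos (4 * t m / m); nlinarith)
        (bernoulli_mgf_le_hoeffding hq0 hq1 (4 * t m / m)) m
      refine (mul_le_mul_of_nonneg_left h1 (Real.exp_pos _).le).trans ?_
      rw [← Real.exp_nat_mul, ← Real.exp_add]
      refine Real.exp_le_exp.mpr (le_of_eq ?_)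
      have hm' : (m : ℝ) ≠ 0 := by positivity
      have e : -(4 * t m / m * (q * m + t m)) + m * (4 * t m / m * q + (4 * t m / m) ^ 2 / 8) =
        -(2 * t m ^ 2 / m) := by field_simp; ring
      rw [e, ht2]
      field_simp

/-- Few samples in a set `G` of large probability are unlikely. -/
theorem iidProb_hits_lt {p : S → ℝ} (hp0 : ∀ s, 0 ≤ p s) (hp1 : ∑ s, p s = 1)
    (G : Finset S) {L : ℝ} (n : ℕ) (hG : 8 * L < n * ∑ s ∈ G, p s) :
    iidProb p n (fun ω => (hits G ω : ℝ) < n * (∑ s ∈ G, p s) / 2) ≤ Real.exp (-L) := by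
  set R := ∑ s ∈ G, p s with hR
  have hR0 : 0 ≤ R := Finset.sum_nonneg fun s _ => hp0 s
  have hR1 : R ≤ 1 := by
    rw [← hp1]; exact Finset.sum_le_univ_sum_of_nonneg hp0
  have hlog := Real.log_two_lt_d9
  have hlog0 : 0 < Real.log 2 := Real.log_pos (by norm_num)
  -- Chernoff's method with `θ = 1/2`
  have h := iidProb_chernoff (n := n) (G := Finset.univ) (H := G) hp0 hp1 (Finset.subset_univ _)
    (q := R) (by rw [hp1, mul_one])
    (bad := fun m k => m = n ∧ (k : ℝ) < n * R / 2) (θ := fun _ => Real.exp (-Real.log 2))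
    (c := fun m => if m = n then Real.exp (Real.log 2 * (n * R / 2)) else 0)
    (β := Real.exp (-L)) (fun _ => (Real.exp_pos _).le) (fun m => ?_) (fun m k h => ?_)
    (fun m => ?_)
  · simpa [hits_univ] using h
  · split_ifs
    · exact (Real.exp_pos _).le
    · exact le_rfl
  · rw [if_pos h.1, ← Real.exp_nat_mul, ← Real.exp_add]
    refine Real.one_le_exp ?_
    nlinarith [h.2]
  · split_ifs with hm
    · subst hm
      have e : 1 - R + R * Real.exp (-Real.log 2) = 1 - R / 2 := by
        rw [Real.exp_neg, Real.exp_log (by norm_num)]; ring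
      rw [e]
      have h1 : (1 - R / 2) ^ m ≤ Real.exp (-(R / 2)) ^ m :=
        pow_le_pow_left₀ (by linarith) (by have := Real.add_one_le_exp (-(R / 2)); linarith) m
      refine (mul_le_mul_of_nonneg_left h1 (Real.exp_pos _).le).trans ?_
      rw [← Real.exp_nat_mul, ← Real.exp_add]
      refine Real.exp_le_exp.mpr ?_
      have : 0 ≤ m * R := by positivity
      nlinarith
    · simp [(Real.exp_pos _).le]

end Iid

/-! ### Marginals and the union bound for the generative model -/

section Generative

variable {S A : Type*} [Fintype S] [Fintype A] [DecidableEq S] [DecidableEq A]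

/-- The samples of the pair `(s₀, a₀)` are independent with the law `P s₀ a₀`. -/
theorem sum_dataset_marginal (P : TransitionKernel S A) (n₀ : ℕ) (s₀ : S) (a₀ : A)
    (F : (Fin n₀ → S) → ℝ) :
    ∑ D : Dataset S A n₀, (∏ s, ∏ a, ∏ i, P s a (D s a i)) * F (D s₀ a₀) =
      iidExp (fun s' => P s₀ a₀ s') n₀ F := by
  have h1 : ∀ s a, ∑ ω : Fin n₀ → S, ∏ i, P s a (ω i) = 1 := fun s a => by
    have := iidExp_const (p := fun s' => P s a s') (stdSimplex.sum_eq_one _) n₀ 1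
    simpa [iidExp] using this
  -- the factor `F` is merged into the factor of the pair `(s₀, a₀)`
  set w : S → A → (Fin n₀ → S) → ℝ := fun s a ω =>
    (∏ i, P s a (ω i)) * if s = s₀ then (if a = a₀ then F ω else 1) else 1 with hw
  have h2 : ∀ D : Dataset S A n₀, (∏ s, ∏ a, ∏ i, P s a (D s a i)) * F (D s₀ a₀) =
      ∏ s, ∏ a, w s a (D s a) := by
    intro D
    have e : ∏ s, ∏ a, (if s = s₀ then (if a = a₀ then F (D s a) else 1) else 1) =
        F (D s₀ a₀) := by
      rw [Finset.prod_eq_single s₀ (fun s _ hs => by simp [hs]) (by simp)]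
      simp
    simp only [hw, Finset.prod_mul_distrib]
    rw [e]
  have h3 : ∑ D : Dataset S A n₀, ∏ s, ∏ a, w s a (D s a) = ∏ s, ∏ a, ∑ ω, w s a ω := by
    have e1 : ∀ s, ∏ a, ∑ ω, w s a ω = ∑ g : A → Fin n₀ → S, ∏ a, w s a (g a) := fun s => by
      rw [Finset.prod_univ_sum, Fintype.piFinset_univ]
    simp_rw [e1]
    rw [Finset.prod_univ_sum, Fintype.piFinset_univ]
  rw [Finset.sum_congr rfl fun D _ => h2 D, h3, Finset.prod_eq_single s₀, Finset.prod_eq_single a₀]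
  · simp [hw, iidExp]
  · intro a _ ha
    simp [hw, ha, h1]
  · simp
  · intro s _ hs
    simp [hw, hs, h1]
  · simp

/-- If every dataset outside `E` shows one of the bad events `bad j`, each of which concerns the
samples of a single pair, then the probability of `E` is at least `1 - Σ Pr(bad j)`. -/
theorem generativeProb_ge {J : Type*} [Fintype J] (P : TransitionKernel S A) (n₀ : ℕ)
    (E : Set (Dataset S A n₀)) (z : J → S × A) (bad : J → (Fin n₀ → S) → Prop)
    (h : ∀ D, D ∉ E → ∃ j, bad j (D (z j).1 (z j).2)) :
    1 - ∑ j, iidProb (fun s' => P (z j).1 (z j).2 s') n₀ (bad j) ≤ generativeProb P n₀ E := by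
  classical
  set W : Dataset S A n₀ → ℝ := fun D => ∏ s, ∏ a, ∏ i, P s a (D s a i) with hW
  have hW0 : ∀ D, 0 ≤ W D := fun D => Finset.prod_nonneg fun _ _ => Finset.prod_nonneg fun _ _ =>
    Finset.prod_nonneg fun _ _ => stdSimplex.zero_le _ _
  have htot : ∑ D, W D = 1 := by
    by_cases hne : Nonempty (S × A)
    · obtain ⟨s₀, a₀⟩ := hne
      have := sum_dataset_marginal P n₀ s₀ a₀ (fun _ => 1)
      simp only [mul_one] at this
      rw [hW, this]
      exact iidExp_const (stdSimplex.sum_eq_one _) n₀ 1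
    · have hW1 : ∀ D, W D = 1 := fun D => Finset.prod_eq_one fun s _ => Finset.prod_eq_one
        fun a _ => (hne ⟨(s, a)⟩).elim
      have : Unique (Dataset S A n₀) :=
        ⟨⟨fun s a => (hne ⟨(s, a)⟩).elim⟩, fun D => by funext s a; exact (hne ⟨(s, a)⟩).elim⟩
      simp [hW1]
  have hbad : ∀ j, iidProb (fun s' => P (z j).1 (z j).2 s') n₀ (bad j) =
      ∑ D, W D * if bad j (D (z j).1 (z j).2) then 1 else 0 := fun j => by
    rw [iidProb, ← sum_dataset_marginal]
  rw [sub_le_iff_le_add, ← htot, generativeProb, Finset.sum_congr rfl fun j _ => hbad j,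
    Finset.sum_comm, ← Finset.sum_add_distrib]
  refine Finset.sum_le_sum fun D _ => ?_
  rw [← Finset.mul_sum]
  have hs : 0 ≤ ∑ j, (if bad j (D (z j).1 (z j).2) then (1 : ℝ) else 0) :=
    Finset.sum_nonneg fun j _ => by split_ifs <;> norm_num
  by_cases hD : D ∈ E
  · rw [Set.indicator_of_mem hD]
    have := mul_nonneg (hW0 D) hs
    linarith
  · obtain ⟨j, hj⟩ := h D hD
    rw [Set.indicator_of_notMem hD, zero_add]
    have h1 : (1 : ℝ) ≤ ∑ j, (if bad j (D (z j).1 (z j).2) then (1 : ℝ) else 0) := by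
      refine le_trans ?_ (Finset.single_le_sum (fun j _ => ?_) (Finset.mem_univ j))
      · simp [hj]
      · split_ifs <;> norm_num
    exact le_mul_of_one_le_right (hW0 D) h1

end Generative

/-! ### From counts to confidence radii -/

/-- Bernstein's inequality with the true variance `v` implies the one with the empirical variance
`w`. -/
theorem bernstein_empirical {D v w b : ℝ} (hv : 0 ≤ v) (hw : 0 ≤ w) (hb : 0 ≤ b)
    (h : D ≤ √(2 * v * b) + b) (hvw : v - w ≤ D) : D ≤ √(2 * w * b) + 4 * b := by
  set s := √(2 * b) with hs
  set x := √v with hx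
  set y := √w with hy
  have e1 : √(2 * v * b) = x * s := by
    rw [hx, hs, ← Real.sqrt_mul hv]; congr 1; ring
  have e2 : √(2 * w * b) = y * s := by
    rw [hy, hs, ← Real.sqrt_mul hw]; congr 1; ring
  have hs2 : s ^ 2 = 2 * b := Real.sq_sqrt (by positivity)
  have hx2 : x ^ 2 = v := Real.sq_sqrt hv
  have hy2 : y ^ 2 = w := Real.sq_sqrt hw
  have hs0 : 0 ≤ s := Real.sqrt_nonneg _
  have hx0 : 0 ≤ x := Real.sqrt_nonneg _
  have hy0 : 0 ≤ y := Real.sqrt_nonneg _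
  rw [e1] at h
  rw [e2]
  have hxy : x ≤ y + 3 / 2 * s := by
    by_contra hc
    push Not at hc
    nlinarith [mul_nonneg hy0 hs0, mul_pos (sub_pos.mpr hc) (sub_pos.mpr hc)]
  nlinarith [mul_le_mul_of_nonneg_right hxy hs0]

/-- A deviation of counts, divided by the number of trials. -/
theorem div_le_of_count {D V L n : ℝ} (hn : 0 < n) (h : D * n ≤ √(V * L * n) + L) :
    D ≤ √(V * (L / n)) + L / n := by
  have e : √(V * (L / n)) = √(V * L * n) / n := by
    rw [eq_div_iff hn.ne', ← Real.sqrt_sq hn.le, ← Real.sqrt_mul' _ (by positivity),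
      Real.sqrt_sq hn.le]
    congr 1; field_simp
  rw [e, ← add_div, le_div_iff₀ hn]
  exact h

/-- The variance of the empirical frequency `q` exceeds that of `p` by at most `|p - q|`. -/
theorem bernoulli_variance_sub_le {p q : ℝ} (hp0 : 0 ≤ p) (hp1 : p ≤ 1) (hq0 : 0 ≤ q)
    (hq1 : q ≤ 1) : p * (1 - p) - q * (1 - q) ≤ |p - q| := by
  have : p * (1 - p) - q * (1 - q) = (p - q) * (1 - p - q) := by ring
  rw [this]
  calc _ ≤ |(p - q) * (1 - p - q)| := le_abs_self _
    _ = |p - q| * |1 - p - q| := abs_mul _ _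
    _ ≤ |p - q| * 1 := mul_le_mul_of_nonneg_left (abs_le.mpr ⟨by linarith, by linarith⟩)
        (abs_nonneg _)
    _ = _ := mul_one _

/-- The two parts of the confidence radius contain the truth when the count `k` of a successor
among `n` steps deviates from its mean as in Bernstein's and Hoeffding's inequalities. The radius
has the smaller number `k` in place of `n`, which only makes it larger. -/
theorem le_radius_of_count {p L L₂ : ℝ} (hp0 : 0 ≤ p) (hp1 : p ≤ 1) (hL : 0 ≤ L) (hL₂ : 0 ≤ L₂)
    {n k : ℕ} (hk : k ≠ 0) (hkn : k ≤ n)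
    (hB : |(k : ℝ) - p * n| ≤ √(2 * (p * (1 - p)) * L * n) + L)
    (hH : |(k : ℝ) - p * n| ≤ √(L₂ * n / 2)) :
    |p - k / n| ≤ min (√(2 * ((k : ℝ) / n) * (1 - k / n) * L / k) + 4 * L / k)
      (√(L₂ / (2 * k))) := by
  have hk0 : (0 : ℝ) < k := by positivity
  have hkn' : (k : ℝ) ≤ n := by exact_mod_cast hkn
  have hn0 : (0 : ℝ) < n := by linarith
  have hq0 : (0 : ℝ) ≤ k / n := by positivity
  have hq1 : (k : ℝ) / n ≤ 1 := (div_le_one hn0).mpr hkn'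
  have e : |p - k / n| * n = |(k : ℝ) - p * n| := by
    rw [← abs_of_pos hn0, ← abs_mul, abs_of_pos hn0, abs_sub_comm]
    congr 1; field_simp
  refine le_min ?_ ?_
  · rw [← e] at hB
    have h1 := div_le_of_count hn0 hB
    have hw : 0 ≤ (k : ℝ) / n * (1 - k / n) := mul_nonneg hq0 (sub_nonneg.mpr hq1)
    have h2 := bernstein_empirical (mul_nonneg hp0 (sub_nonneg.mpr hp1)) hw
      (by positivity : 0 ≤ L / n) h1 (bernoulli_variance_sub_le hp0 hp1 hq0 hq1)
    have h3 : L / n ≤ L / k := div_le_div_of_nonneg_left hL hk0 hkn'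
    refine h2.trans (add_le_add (Real.sqrt_le_sqrt ?_) ?_)
    · rw [mul_div_assoc (2 * ((k : ℝ) / n) * (1 - k / n)) L, mul_assoc 2 ((k : ℝ) / n)]
      exact mul_le_mul_of_nonneg_left h3 (by positivity)
    · rw [mul_div_assoc]; linarith
  · refine Real.le_sqrt_of_sq_le ?_
    have h1 : |p - k / n| ^ 2 * n ^ 2 ≤ L₂ * n / 2 := by
      rw [← mul_pow, e]
      calc _ ≤ √(L₂ * n / 2) ^ 2 := pow_le_pow_left₀ (abs_nonneg _) hH 2
        _ = _ := Real.sq_sqrt (by positivity)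
    rw [le_div_iff₀ (by positivity)]
    have h2 : |p - k / n| ^ 2 * n ≤ L₂ / 2 := by
      have : |p - k / n| ^ 2 * n * n ≤ L₂ / 2 * n := by nlinarith
      exact le_of_mul_le_mul_right this hn0
    nlinarith [mul_le_mul_of_nonneg_left hkn' (sq_nonneg |p - (k : ℝ) / n|)]

/-- At a vertex with two children, every kernel in the confidence set is close to the truth.  The
radius of a rare child is too large to be useful, but the two deviations agree, and so the radius
of the frequent child applies. -/
theorem abs_sub_le_of_radius {p p' L : ℝ} (hp0 : 0 ≤ p) (hp1 : p ≤ 1) (hL : 0 ≤ L)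
    {n k : ℕ} (hn : n ≠ 0) (hkn : k ≤ n)
    (hB : |(k : ℝ) - p * n| ≤ √(2 * (p * (1 - p)) * L * n) + L)
    (h1 : k ≠ 0 → |p' - k / n| ≤ √(2 * ((k : ℝ) / n) * (1 - k / n) * L / k) + 4 * L / k)
    (h2 : n - k ≠ 0 → |p' - k / n| ≤
      √(2 * ((k : ℝ) / n) * (1 - k / n) * L / (n - k : ℕ)) + 4 * L / (n - k : ℕ)) :
    |p' - p| ≤ 4 * √(p * (1 - p) * (L / n)) + 11 * (L / n) := by
  have hn0 : (0 : ℝ) < n := by positivity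
  have hkn' : (k : ℝ) ≤ n := by exact_mod_cast hkn
  set q : ℝ := (k : ℝ) / n with hq
  set b := L / n with hb
  have hb0 : 0 ≤ b := by positivity
  have hq0 : 0 ≤ q := by positivity
  have hq1 : q ≤ 1 := (div_le_one hn0).mpr hkn'
  have hkq : (k : ℝ) = q * n := by rw [hq]; field_simp
  have hv0 : 0 ≤ q * (1 - q) := mul_nonneg hq0 (sub_nonneg.mpr hq1)
  have hpv : 0 ≤ p * (1 - p) := mul_nonneg hp0 (sub_nonneg.mpr hp1)
  have hs2 : √(4 * (q * (1 - q) * b)) = 2 * √(q * (1 - q) * b) := by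
    rw [Real.sqrt_mul (by norm_num), show (4 : ℝ) = 2 ^ 2 by norm_num,
      Real.sqrt_sq (by norm_num)]
  have main : ∀ c : ℝ, n / 2 ≤ c → |p' - q| ≤ √(2 * q * (1 - q) * L / c) + 4 * L / c →
      |p' - q| ≤ 2 * √(q * (1 - q) * b) + 8 * b := by
    intro c hc h
    have hLc : L / c ≤ 2 * b := by
      rw [hb, div_le_iff₀ (by linarith)]
      calc L = 2 * (L / n) * (n / 2) := by field_simp
        _ ≤ _ := mul_le_mul_of_nonneg_left hc (by positivity)
    refine h.trans (add_le_add ?_ ?_)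
    · rw [← hs2]
      refine Real.sqrt_le_sqrt ?_
      rw [mul_div_assoc]
      nlinarith
    · rw [mul_div_assoc]; linarith
  have hstep : |p' - q| ≤ 2 * √(q * (1 - q) * b) + 8 * b := by
    rcases le_total (1 / 2) q with h | h
    · refine main k (by nlinarith) (h1 ?_)
      intro h0
      have : (k : ℝ) = 0 := by simp [h0]
      nlinarith
    · have hc : ((n - k : ℕ) : ℝ) = n - k := Nat.cast_sub hkn
      refine main (n - k : ℕ) (by rw [hc]; nlinarith) (h2 ?_)
      intro h0
      have : (n : ℝ) - k = 0 := by rw [← hc, h0]; simp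
      nlinarith
  have e : |p - q| * n = |(k : ℝ) - p * n| := by
    rw [hkq, ← abs_of_pos hn0, ← abs_mul, abs_of_pos hn0, abs_sub_comm]
    congr 1; ring
  rw [← e] at hB
  have hD := div_le_of_count hn0 hB
  rw [← hb] at hD
  set x := √(p * (1 - p) * b) with hx
  have hx0 : 0 ≤ x := Real.sqrt_nonneg _
  have hx2 : x ^ 2 = p * (1 - p) * b := Real.sq_sqrt (by positivity)
  have hvar := bernoulli_variance_sub_le hq0 hq1 hp0 hp1
  rw [abs_sub_comm] at hvar
  have hx1 : √(2 * (p * (1 - p)) * b) ≤ 3 / 2 * x := by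
    refine Real.sqrt_le_iff.mpr ⟨by positivity, ?_⟩
    nlinarith
  have hy : √(q * (1 - q) * b) ≤ x + b := by
    refine Real.sqrt_le_iff.mpr ⟨by positivity, ?_⟩
    nlinarith
  calc |p' - p| ≤ |p' - q| + |q - p| := abs_sub_le _ _ _
    _ ≤ (2 * √(q * (1 - q) * b) + 8 * b) + (3 / 2 * x + b) :=
        add_le_add hstep (by rw [abs_sub_comm]; linarith)
    _ ≤ _ := by linarith

/-! ### Averages with respect to a transition kernel -/

theorem sq_sum_simplex_le {T : Type*} [Fintype T] (p : stdSimplex ℝ T) (g : T → ℝ) :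
    (∑ i, p i * g i) ^ 2 ≤ ∑ i, p i * g i ^ 2 := by
  have h := Finset.sum_sq_le_sum_mul_sum_of_sq_le_mul Finset.univ (r := fun i => p i * g i)
    (f := fun i => p i) (g := fun i => p i * g i ^ 2) (fun i _ => stdSimplex.zero_le _ _)
    (fun i _ => mul_nonneg (stdSimplex.zero_le _ _) (sq_nonneg _)) (fun i _ => le_of_eq (by ring))
  simpa using h

theorem sum_simplex_mem_Icc {T : Type*} [Fintype T] (p : stdSimplex ℝ T) {g : T → ℝ} {B : ℝ}
    (hg : ∀ i, g i ∈ Icc (0 : ℝ) B) : ∑ i, p i * g i ∈ Icc (0 : ℝ) B := by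
  refine ⟨Finset.sum_nonneg fun i _ => mul_nonneg (stdSimplex.zero_le _ _) (hg i).1, ?_⟩
  calc ∑ i, p i * g i ≤ ∑ i, p i * B := Finset.sum_le_sum fun i _ =>
        mul_le_mul_of_nonneg_left (hg i).2 (stdSimplex.zero_le _ _)
    _ = B := by rw [← Finset.sum_mul, stdSimplex.sum_eq_one, one_mul]

section Kernel

variable {S A : Type*} [Fintype S]

/-- The variance of `v` at the next state. -/
def nextVar (P : TransitionKernel S A) (v : S → ℝ) (s : S) (a : A) : ℝ :=
  ∑ s', P s a s' * v s' ^ 2 - (∑ s', P s a s' * v s') ^ 2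

theorem nextVar_nonneg (P : TransitionKernel S A) (v : S → ℝ) (s : S) (a : A) :
    0 ≤ nextVar P v s a := sub_nonneg.mpr (sq_sum_simplex_le _ _)

theorem isClosed_optimisticSet (supp : S → A → Set S) (N : S → A → S → ℕ) (δ : ℝ) :
    IsClosed (optimisticSet supp N δ) := by
  have hP : ∀ s a s', Continuous fun P : TransitionKernel S A => P s a s' := fun s a s' =>
    (continuous_apply s').comp (continuous_subtype_val.comp
      ((continuous_apply a).comp (continuous_apply s)))
  simp only [optimisticSet, ofPred_and, ofPred_forall]
  refine IsClosed.inter ?_ ?_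
  · exact isClosed_iInter fun s => isClosed_iInter fun a => isClosed_iInter fun s' =>
      isClosed_iInter fun _ => isClosed_eq (hP s a s') continuous_const
  · exact isClosed_iInter fun s => isClosed_iInter fun a => isClosed_iInter fun s' =>
      isClosed_iInter fun _ => isClosed_le ((hP s a s').sub continuous_const).abs continuous_const

end Kernel

/-! ### Occupancy measures and Bellman equations -/

section Occupancy

variable {S A : Type*} [Fintype S] [Fintype A] {m : ℕ}

/-- `ν` solves the flow equation of discounted occupancy measures: `ν = μ + γ ν P_π`. -/
def IsFlow (M : SICMDP S A m) (P : TransitionKernel S A) (π : StationaryPolicy S A)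
    (ν : S → ℝ) : Prop :=
  ∀ s', ν s' = M.μ s' + M.γ * ∑ s, ∑ a, ν s * π s a * P s a s'

/-- `v` solves the Bellman equation of the policy `π`: `v = (f + γ P v)_π`. -/
def IsBellman (M : SICMDP S A m) (P : TransitionKernel S A) (π : StationaryPolicy S A)
    (f : S → A → ℝ) (v : S → ℝ) : Prop :=
  ∀ s, v s = ∑ a, π s a * (f s a + M.γ * ∑ s', P s a s' * v s')

theorem stateProb_nonneg (M : SICMDP S A m) (P : TransitionKernel S A)
    (π : StationaryPolicy S A) (t : ℕ) (s : S) : 0 ≤ M.stateProb P π t s := by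
  induction t generalizing s with
  | zero => exact stdSimplex.zero_le _ _
  | succ t ih =>
    exact Finset.sum_nonneg fun s _ => Finset.sum_nonneg fun a _ =>
      mul_nonneg (mul_nonneg (ih s) (stdSimplex.zero_le _ _)) (stdSimplex.zero_le _ _)

theorem sum_weight_policy (π : StationaryPolicy S A) (ν : S → ℝ) :
    ∑ s, ∑ a, ν s * π s a = ∑ s, ν s :=
  Finset.sum_congr rfl fun s _ => by rw [← Finset.mul_sum, stdSimplex.sum_eq_one, mul_one]

theorem sum_weight_kernel (P : TransitionKernel S A) (π : StationaryPolicy S A) (ν : S → ℝ) :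
    ∑ s', ∑ s, ∑ a, ν s * π s a * P s a s' = ∑ s, ν s := by
  rw [Finset.sum_comm, ← sum_weight_policy π ν]
  refine Finset.sum_congr rfl fun s _ => ?_
  rw [Finset.sum_comm]
  refine Finset.sum_congr rfl fun a _ => ?_
  rw [← Finset.mul_sum, stdSimplex.sum_eq_one, mul_one]

theorem sum_stateProb (M : SICMDP S A m) (P : TransitionKernel S A)
    (π : StationaryPolicy S A) (t : ℕ) : ∑ s, M.stateProb P π t s = 1 := by
  induction t with
  | zero => exact stdSimplex.sum_eq_one _
  | succ t ih => rw [← ih]; exact sum_weight_kernel P π _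

theorem stateProb_le_one (M : SICMDP S A m) (P : TransitionKernel S A)
    (π : StationaryPolicy S A) (t : ℕ) (s : S) : M.stateProb P π t s ≤ 1 := by
  rw [← M.sum_stateProb P π t]
  exact Finset.single_le_sum (fun s _ => M.stateProb_nonneg P π t s) (Finset.mem_univ s)

/-- The discounted occupancy measure `Σₜ γ^t Pr(s_t = s)`. -/
noncomputable def occupancy (M : SICMDP S A m) (P : TransitionKernel S A)
    (π : StationaryPolicy S A) (s : S) : ℝ :=
  ∑' t : ℕ, M.γ ^ t * M.stateProb P π t s

theorem summable_occupancy (M : SICMDP S A m) (P : TransitionKernel S A)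
    (π : StationaryPolicy S A) (s : S) : Summable fun t : ℕ => M.γ ^ t * M.stateProb P π t s :=
  Summable.of_nonneg_of_le
    (fun t => mul_nonneg (pow_nonneg M.γ_nonneg t) (M.stateProb_nonneg P π t s))
    (fun t => mul_le_of_le_one_right (pow_nonneg M.γ_nonneg t) (M.stateProb_le_one P π t s))
    (summable_geometric_of_lt_one M.γ_nonneg M.γ_lt_one)

theorem occupancy_nonneg (M : SICMDP S A m) (P : TransitionKernel S A)
    (π : StationaryPolicy S A) (s : S) : 0 ≤ M.occupancy P π s :=
  tsum_nonneg fun t => mul_nonneg (pow_nonneg M.γ_nonneg t) (M.stateProb_nonneg P π t s)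

theorem isFlow_occupancy (M : SICMDP S A m) (P : TransitionKernel S A)
    (π : StationaryPolicy S A) : M.IsFlow P π (M.occupancy P π) := by
  intro s'
  have hs : ∀ s, ∀ a ∈ (Finset.univ : Finset A), Summable fun t : ℕ =>
      M.γ ^ t * M.stateProb P π t s * (π s a * P s a s') := fun s a _ =>
    (M.summable_occupancy P π s).mul_right _
  rw [occupancy, (M.summable_occupancy P π s').tsum_eq_zero_add]
  congr 1
  · simp [stateProb]
  · have e : ∀ t : ℕ, M.γ ^ (t + 1) * M.stateProb P π (t + 1) s' =
        M.γ * ∑ s, ∑ a, M.γ ^ t * M.stateProb P π t s * (π s a * P s a s') := fun t => by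
      rw [stateProb, pow_succ', mul_assoc, Finset.mul_sum]
      congr 1
      refine Finset.sum_congr rfl fun s _ => ?_
      rw [Finset.mul_sum]
      exact Finset.sum_congr rfl fun a _ => by ring
    rw [tsum_congr e, tsum_mul_left, Summable.tsum_finsetSum fun s _ => summable_sum (hs s)]
    congr 1
    refine Finset.sum_congr rfl fun s _ => ?_
    rw [Summable.tsum_finsetSum (hs s)]
    exact Finset.sum_congr rfl fun a _ => by rw [tsum_mul_right, occupancy]; ring

theorem value_eq_occupancy (M : SICMDP S A m) (P : TransitionKernel S A)
    (π : StationaryPolicy S A) (f : S → A → ℝ) :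
    M.value P π f = ∑ s, ∑ a, M.occupancy P π s * π s a * f s a := by
  have hs : ∀ s, ∀ a ∈ (Finset.univ : Finset A), Summable fun t : ℕ =>
      M.γ ^ t * M.stateProb P π t s * (π s a * f s a) := fun s a _ =>
    (M.summable_occupancy P π s).mul_right _
  have e : ∀ t : ℕ, M.γ ^ t * ∑ s, ∑ a, M.stateProb P π t s * π s a * f s a =
      ∑ s, ∑ a, M.γ ^ t * M.stateProb P π t s * (π s a * f s a) := fun t => by
    rw [Finset.mul_sum]
    refine Finset.sum_congr rfl fun s _ => ?_
    rw [Finset.mul_sum]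
    exact Finset.sum_congr rfl fun a _ => by ring
  rw [value, tsum_congr e, Summable.tsum_finsetSum fun s _ => summable_sum (hs s)]
  refine Finset.sum_congr rfl fun s _ => ?_
  rw [Summable.tsum_finsetSum (hs s)]
  exact Finset.sum_congr rfl fun a _ => by rw [tsum_mul_right, occupancy]; ring

theorem IsFlow.sum_eq {M : SICMDP S A m} {P : TransitionKernel S A} {π : StationaryPolicy S A}
    {ν : S → ℝ} (h : M.IsFlow P π ν) : ∑ s, ν s = 1 / (1 - M.γ) := by
  have h1 : ∑ s, ν s = 1 + M.γ * ∑ s, ν s := by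
    conv_lhs => rw [Finset.sum_congr rfl fun s _ => h s]
    rw [Finset.sum_add_distrib, ← Finset.mul_sum, sum_weight_kernel, stdSimplex.sum_eq_one]
  have := M.γ_lt_one
  rw [eq_div_iff (by linarith)]
  linarith

/-- Testing the flow equation against a function. -/
theorem IsFlow.sum_mul {M : SICMDP S A m} {P : TransitionKernel S A} {π : StationaryPolicy S A}
    {ν : S → ℝ} (h : M.IsFlow P π ν) (g : S → ℝ) :
    ∑ s, ν s * g s = ∑ s, M.μ s * g s +
      M.γ * ∑ s, ∑ a, ν s * π s a * ∑ s', P s a s' * g s' := by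
  conv_lhs => rw [Finset.sum_congr rfl fun s _ => by rw [h s]]
  simp_rw [add_mul, Finset.sum_add_distrib, mul_assoc M.γ, ← Finset.mul_sum]
  congr 2
  simp_rw [Finset.sum_mul, Finset.mul_sum]
  rw [Finset.sum_comm]
  refine Finset.sum_congr rfl fun s _ => ?_
  rw [Finset.sum_comm]
  exact Finset.sum_congr rfl fun a _ => Finset.sum_congr rfl fun s' _ => by ring

/-- The performance difference of two kernels `P` and `P'`, as the model error along the occupancy
measure of `P`. -/
theorem IsFlow.sum_mul_eq_of_isBellman {M : SICMDP S A m} {P P' : TransitionKernel S A}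
    {π : StationaryPolicy S A} {ν : S → ℝ} (h : M.IsFlow P π ν) {f : S → A → ℝ} {v : S → ℝ}
    (hv : M.IsBellman P' π f v) :
    ∑ s, M.μ s * v s - ∑ s, ∑ a, ν s * π s a * f s a =
      ∑ s, ∑ a, ν s * π s a * (M.γ * (∑ s', P' s a s' * v s' - ∑ s', P s a s' * v s')) := by
  have h1 := h.sum_mul v
  have h2 : ∑ s, ν s * v s = ∑ s, ∑ a, ν s * π s a * f s a +
      M.γ * ∑ s, ∑ a, ν s * π s a * ∑ s', P' s a s' * v s' := by
    rw [Finset.mul_sum, ← Finset.sum_add_distrib]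
    refine Finset.sum_congr rfl fun s _ => ?_
    rw [hv s, Finset.mul_sum, Finset.mul_sum, ← Finset.sum_add_distrib]
    exact Finset.sum_congr rfl fun a _ => by ring
  have h3 : ∑ s, ∑ a, ν s * π s a *
      (M.γ * (∑ s', P' s a s' * v s' - ∑ s', P s a s' * v s')) =
      M.γ * ∑ s, ∑ a, ν s * π s a * ∑ s', P' s a s' * v s' -
      M.γ * ∑ s, ∑ a, ν s * π s a * ∑ s', P s a s' * v s' := by
    rw [Finset.mul_sum, Finset.mul_sum, ← Finset.sum_sub_distrib]
    refine Finset.sum_congr rfl fun s _ => ?_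
    rw [Finset.mul_sum, Finset.mul_sum, ← Finset.sum_sub_distrib]
    exact Finset.sum_congr rfl fun a _ => by ring
  rw [h3]
  linarith

theorem exists_isBellman (M : SICMDP S A m) (P : TransitionKernel S A)
    (π : StationaryPolicy S A) {f : S → A → ℝ} (hf : ∀ s a, f s a ∈ Icc (0 : ℝ) 1) :
    ∃ v, M.IsBellman P π f v ∧ ∀ s, v s ∈ Icc (0 : ℝ) (1 / (1 - M.γ)) := by
  -- `F t s` is the expected value of `f` at time `t`, when the process starts at `s`
  set F : ℕ → S → ℝ := fun t => Nat.rec (fun s => ∑ a, π s a * f s a)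
    (fun _ g s => ∑ a, π s a * ∑ s', P s a s' * g s') t with hF
  have hF0 : ∀ s, F 0 s = ∑ a, π s a * f s a := fun s => rfl
  have hFs : ∀ t s, F (t + 1) s = ∑ a, π s a * ∑ s', P s a s' * F t s' := fun t s => rfl
  have hmem : ∀ t s, F t s ∈ Icc (0 : ℝ) 1 := by
    intro t
    induction t with
    | zero => exact fun s => sum_simplex_mem_Icc _ (hf s)
    | succ t ih => exact fun s => sum_simplex_mem_Icc _ fun a => sum_simplex_mem_Icc _ ih
  have hgeo := summable_geometric_of_lt_one M.γ_nonneg M.γ_lt_one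
  have hle : ∀ t s, M.γ ^ t * F t s ≤ M.γ ^ t := fun t s =>
    mul_le_of_le_one_right (pow_nonneg M.γ_nonneg t) (hmem t s).2
  have hnn : ∀ t s, 0 ≤ M.γ ^ t * F t s := fun t s =>
    mul_nonneg (pow_nonneg M.γ_nonneg t) (hmem t s).1
  have hsum : ∀ s, Summable fun t : ℕ => M.γ ^ t * F t s := fun s =>
    Summable.of_nonneg_of_le (fun t => hnn t s) (fun t => hle t s) hgeo
  refine ⟨fun s => ∑' t : ℕ, M.γ ^ t * F t s, fun s => ?_, fun s =>
    ⟨tsum_nonneg fun t => hnn t s, ?_⟩⟩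
  · have hs : ∀ a, ∀ s' ∈ (Finset.univ : Finset S), Summable fun t : ℕ =>
        M.γ ^ t * F t s' * (M.γ * π s a * P s a s') := fun a s' _ => (hsum s').mul_right _
    have e : ∀ t : ℕ, M.γ ^ (t + 1) * F (t + 1) s =
        ∑ a, ∑ s', M.γ ^ t * F t s' * (M.γ * π s a * P s a s') := fun t => by
      rw [hFs, Finset.mul_sum]
      refine Finset.sum_congr rfl fun a _ => ?_
      rw [Finset.mul_sum, Finset.mul_sum]
      exact Finset.sum_congr rfl fun s' _ => by ring
    simp only
    rw [(hsum s).tsum_eq_zero_add, tsum_congr e,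
      Summable.tsum_finsetSum fun a _ => summable_sum (hs a), pow_zero, one_mul, hF0,
      ← Finset.sum_add_distrib]
    refine Finset.sum_congr rfl fun a _ => ?_
    rw [Summable.tsum_finsetSum (hs a), mul_add, Finset.mul_sum, Finset.mul_sum]
    congr 1
    exact Finset.sum_congr rfl fun s' _ => by rw [tsum_mul_right]; ring
  · rw [one_div, ← tsum_geometric_of_lt_one M.γ_nonneg M.γ_lt_one]
    exact (hsum s).tsum_le_tsum (fun t => hle t s) hgeo

theorem value_eq_of_isBellman (M : SICMDP S A m) (P : TransitionKernel S A)
    (π : StationaryPolicy S A) {f : S → A → ℝ} {v : S → ℝ} (hv : M.IsBellman P π f v) :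
    M.value P π f = ∑ s, M.μ s * v s := by
  have h := (M.isFlow_occupancy P π).sum_mul_eq_of_isBellman hv
  simp only [sub_self, mul_zero, Finset.sum_const_zero] at h
  rw [value_eq_occupancy]
  linarith

/-- The flow equation determines the value, although its solution is not assumed to be the
occupancy measure. -/
theorem value_eq_of_isFlow (M : SICMDP S A m) (P : TransitionKernel S A)
    (π : StationaryPolicy S A) {f : S → A → ℝ} (hf : ∀ s a, f s a ∈ Icc (0 : ℝ) 1) {ν : S → ℝ}
    (hν : M.IsFlow P π ν) : M.value P π f = ∑ s, ∑ a, ν s * π s a * f s a := by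
  obtain ⟨v, hv, -⟩ := M.exists_isBellman P π hf
  have h := hν.sum_mul_eq_of_isBellman hv
  simp only [sub_self, mul_zero, Finset.sum_const_zero] at h
  rw [M.value_eq_of_isBellman P π hv]
  linarith

theorem value_mem_Icc (M : SICMDP S A m) (P : TransitionKernel S A)
    (π : StationaryPolicy S A) {f : S → A → ℝ} (hf : ∀ s a, f s a ∈ Icc (0 : ℝ) 1) :
    M.value P π f ∈ Icc (0 : ℝ) (1 / (1 - M.γ)) := by
  rw [value_eq_occupancy, ← (M.isFlow_occupancy P π).sum_eq, ← sum_weight_policy π]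
  have h : ∀ s a, 0 ≤ M.occupancy P π s * π s a := fun s a =>
    mul_nonneg (M.occupancy_nonneg P π s) (stdSimplex.zero_le _ _)
  exact ⟨Finset.sum_nonneg fun s _ => Finset.sum_nonneg fun a _ => mul_nonneg (h s a) (hf s a).1,
    Finset.sum_le_sum fun s _ => Finset.sum_le_sum fun a _ =>
      mul_le_of_le_one_right (h s a) (hf s a).2⟩

/-! ### The total variance of the value function along the process -/

/-- The total variance bound, for an occupancy measure of the kernel `P` and a value function of
another kernel `P'`.  The mismatch enters through the model error itself, so that the resulting
estimate of the model error is self-bounding. -/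
theorem sum_nextVar_le {M : SICMDP S A m} {P P' : TransitionKernel S A}
    {π : StationaryPolicy S A} {ν : S → ℝ} (hν0 : ∀ s, 0 ≤ ν s) (hν : M.IsFlow P π ν)
    {f : S → A → ℝ} (hf : ∀ s a, f s a ∈ Icc (0 : ℝ) 1) {v : S → ℝ}
    (hv : M.IsBellman P' π f v) (hvB : ∀ s, v s ∈ Icc (0 : ℝ) (1 / (1 - M.γ))) :
    M.γ ^ 2 * ∑ s, ∑ a, ν s * π s a * nextVar P v s a ≤
      2 * (1 / (1 - M.γ)) ^ 2 + 2 * (1 / (1 - M.γ)) * ∑ s, ∑ a, ν s * π s a *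
        |M.γ * (∑ s', P' s a s' * v s' - ∑ s', P s a s' * v s')| := by
  set B := 1 / (1 - M.γ) with hB
  have hγ0 := M.γ_nonneg
  have hγ1 := M.γ_lt_one
  have hB0 : 0 < B := one_div_pos.mpr (by linarith)
  have hBγ : 1 + M.γ * B = B := by
    have : 1 - M.γ ≠ 0 := by linarith
    rw [hB]; field_simp; ring
  have hω : ∀ s a, 0 ≤ ν s * π s a := fun s a => mul_nonneg (hν0 s) (stdSimplex.zero_le _ _)
  set Pv : S → A → ℝ := fun s a => ∑ s', P s a s' * v s' with hPv
  set P'v : S → A → ℝ := fun s a => ∑ s', P' s a s' * v s' with hP'v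
  set h : S → A → ℝ := fun s a => f s a + M.γ * P'v s a with hh
  have hP'v0 : ∀ s a, 0 ≤ P'v s a := fun s a => (sum_simplex_mem_Icc _ hvB).1
  have hP'vB : ∀ s a, P'v s a ≤ B := fun s a => (sum_simplex_mem_Icc _ hvB).2
  have hh0 : ∀ s a, 0 ≤ h s a := fun s a =>
    add_nonneg (hf s a).1 (mul_nonneg hγ0 (hP'v0 s a))
  have hhB : ∀ s a, h s a ≤ B := fun s a => by
    have := mul_le_mul_of_nonneg_left (hP'vB s a) hγ0
    have := (hf s a).2
    simp only [hh]
    linarith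
  -- by Jensen's inequality, `v²` may be replaced with the average of `h²`
  have hflow : M.γ * ∑ s, ∑ a, ν s * π s a * ∑ s', P s a s' * v s' ^ 2 ≤
      ∑ s, ∑ a, ν s * π s a * h s a ^ 2 := by
    have h1 := hν.sum_mul (fun s => v s ^ 2)
    have h2 : 0 ≤ ∑ s, M.μ s * v s ^ 2 := Finset.sum_nonneg fun s _ =>
      mul_nonneg (stdSimplex.zero_le _ _) (sq_nonneg _)
    have h3 : ∑ s, ν s * v s ^ 2 ≤ ∑ s, ∑ a, ν s * π s a * h s a ^ 2 := by
      refine Finset.sum_le_sum fun s _ => ?_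
      have := sq_sum_simplex_le (π s) (h s)
      rw [← hv s] at this
      simp_rw [mul_assoc, ← Finset.mul_sum]
      exact mul_le_mul_of_nonneg_left this (hν0 s)
    linarith
  have hpt : ∀ s a, h s a ^ 2 - (M.γ * Pv s a) ^ 2 ≤
      2 * B + 2 * B * |M.γ * (P'v s a - Pv s a)| := fun s a => by
    set g := M.γ * (P'v s a - Pv s a) with hg
    have e : M.γ * Pv s a = h s a - (f s a + g) := by simp only [hh, hg]; ring
    rw [e]
    have h1 : h s a * f s a ≤ B := by
      calc h s a * f s a ≤ h s a * 1 := mul_le_mul_of_nonneg_left (hf s a).2 (hh0 s a)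
        _ ≤ B := by rw [mul_one]; exact hhB s a
    have h2 : h s a * g ≤ B * |g| :=
      (mul_le_mul_of_nonneg_left (le_abs_self g) (hh0 s a)).trans
        (mul_le_mul_of_nonneg_right (hhB s a) (abs_nonneg g))
    nlinarith [sq_nonneg (f s a + g)]
  have hvar : M.γ ^ 2 * ∑ s, ∑ a, ν s * π s a * nextVar P v s a =
      M.γ * (M.γ * ∑ s, ∑ a, ν s * π s a * ∑ s', P s a s' * v s' ^ 2) -
        ∑ s, ∑ a, ν s * π s a * (M.γ * Pv s a) ^ 2 := by
    simp_rw [Finset.mul_sum, ← Finset.sum_sub_distrib]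
    refine Finset.sum_congr rfl fun s _ => Finset.sum_congr rfl fun a _ => ?_
    rw [nextVar]
    simp_rw [← Finset.mul_sum]
    ring
  have hX0 : 0 ≤ M.γ * ∑ s, ∑ a, ν s * π s a * ∑ s', P s a s' * v s' ^ 2 :=
    mul_nonneg hγ0 (Finset.sum_nonneg fun s _ => Finset.sum_nonneg fun a _ =>
      mul_nonneg (hω s a) (Finset.sum_nonneg fun s' _ =>
        mul_nonneg (stdSimplex.zero_le _ _) (sq_nonneg _)))
  have hsumω : ∑ s, ∑ a, ν s * π s a = B := by rw [sum_weight_policy, hν.sum_eq]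
  calc _ ≤ ∑ s, ∑ a, ν s * π s a * h s a ^ 2 -
        ∑ s, ∑ a, ν s * π s a * (M.γ * Pv s a) ^ 2 := by
        rw [hvar]; nlinarith
    _ = ∑ s, ∑ a, ν s * π s a * (h s a ^ 2 - (M.γ * Pv s a) ^ 2) := by
        simp_rw [← Finset.sum_sub_distrib, mul_sub]
    _ ≤ ∑ s, ∑ a, ν s * π s a * (2 * B + 2 * B * |M.γ * (P'v s a - Pv s a)|) :=
        Finset.sum_le_sum fun s _ => Finset.sum_le_sum fun a _ =>
          mul_le_mul_of_nonneg_left (hpt s a) (hω s a)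
    _ = 2 * B * (∑ s, ∑ a, ν s * π s a) + 2 * B * ∑ s, ∑ a, ν s * π s a *
        |M.γ * (P'v s a - Pv s a)| := by
        simp_rw [Finset.mul_sum, ← Finset.sum_add_distrib]
        exact Finset.sum_congr rfl fun s _ => Finset.sum_congr rfl fun a _ => by ring
    _ = _ := by rw [hsumω]; ring

/-- A bound on `X` in terms of its own square root.  If `X > ε`, the hypotheses give
`V Ξ ≤ 4 X ^ 2 / 2048 ≤ (X / 16) ^ 2`, and then `X ≤ 4 X / 16 + 11 X / 2048 < X`. -/
theorem le_of_self_bounding {X V B Ξ ε : ℝ} (hX : 0 ≤ X) (hΞ : 0 ≤ Ξ) (hε : 0 < ε)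
    (h : X ≤ 4 * √(V * Ξ) + 11 * B * Ξ) (hV : V ≤ 2 * B ^ 2 + 2 * B * X)
    (h1 : B * Ξ ≤ ε / 2048) (h2 : B ^ 2 * Ξ ≤ ε ^ 2 / 2048) : X ≤ ε := by
  by_contra hc
  push Not at hc
  have h3 : V * Ξ ≤ (X / 16) ^ 2 := by
    have := mul_le_mul_of_nonneg_right hV hΞ
    nlinarith [mul_le_mul_of_nonneg_right h1 hX]
  have h4 : √(V * Ξ) ≤ X / 16 := by
    rw [← Real.sqrt_sq (by positivity : 0 ≤ X / 16)]
    exact Real.sqrt_le_sqrt h3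
  nlinarith

/-- If the model error at each pair is controlled by the standard deviation of the next value, with
rates `ρ` that are small on average, then the two kernels assign nearly the same value to `π`. -/
theorem abs_value_sub_le (M : SICMDP S A m) {P P' : TransitionKernel S A}
    {π : StationaryPolicy S A} {ν : S → ℝ} (hν0 : ∀ s, 0 ≤ ν s) (hν : M.IsFlow P π ν)
    {f : S → A → ℝ} (hf : ∀ s a, f s a ∈ Icc (0 : ℝ) 1) {ρ : S → A → ℝ}
    (hρ0 : ∀ s a, 0 ≤ ρ s a)
    (hρ : ∀ s a, ν s ≠ 0 → ∀ v : S → ℝ, (∀ s, v s ∈ Icc (0 : ℝ) (1 / (1 - M.γ))) →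
      |∑ s', P' s a s' * v s' - ∑ s', P s a s' * v s'| ≤
        4 * √(nextVar P v s a * ρ s a) + 11 * (1 / (1 - M.γ)) * ρ s a)
    {ε : ℝ} (hε : 0 < ε)
    (h1 : 1 / (1 - M.γ) * ∑ s, ∑ a, ν s * π s a * ρ s a ≤ ε / 2048)
    (h2 : (1 / (1 - M.γ)) ^ 2 * ∑ s, ∑ a, ν s * π s a * ρ s a ≤ ε ^ 2 / 2048) :
    |M.value P' π f - M.value P π f| ≤ ε := by
  obtain ⟨v, hv, hvB⟩ := M.exists_isBellman P' π hf
  have hγ0 := M.γ_nonneg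
  have hγ1 := M.γ_lt_one
  have hω : ∀ s a, 0 ≤ ν s * π s a := fun s a => mul_nonneg (hν0 s) (stdSimplex.zero_le _ _)
  set B := 1 / (1 - M.γ) with hB
  have hB0 : 0 < B := one_div_pos.mpr (by linarith)
  set X := ∑ s, ∑ a, ν s * π s a *
    |M.γ * (∑ s', P' s a s' * v s' - ∑ s', P s a s' * v s')| with hX
  set Ξ := ∑ s, ∑ a, ν s * π s a * ρ s a with hΞ
  set V := M.γ ^ 2 * ∑ s, ∑ a, ν s * π s a * nextVar P v s a with hV
  have hX0 : 0 ≤ X := Finset.sum_nonneg fun s _ => Finset.sum_nonneg fun a _ =>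
    mul_nonneg (hω s a) (abs_nonneg _)
  have hΞ0 : 0 ≤ Ξ := Finset.sum_nonneg fun s _ => Finset.sum_nonneg fun a _ =>
    mul_nonneg (hω s a) (hρ0 s a)
  have hdiff : |M.value P' π f - M.value P π f| ≤ X := by
    rw [M.value_eq_of_isBellman P' π hv, M.value_eq_of_isFlow P π hf hν,
      hν.sum_mul_eq_of_isBellman hv]
    refine (Finset.abs_sum_le_sum_abs _ _).trans (Finset.sum_le_sum fun s _ => ?_)
    refine (Finset.abs_sum_le_sum_abs _ _).trans (Finset.sum_le_sum fun a _ => ?_)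
    rw [abs_mul, abs_of_nonneg (hω s a)]
  have hvar0 := nextVar_nonneg P v
  have hXle : X ≤ 4 * √(V * Ξ) + 11 * B * Ξ := by
    have hpt : ∀ s a, ν s * π s a * |M.γ * (∑ s', P' s a s' * v s' - ∑ s', P s a s' * v s')| ≤
        4 * (M.γ * √(ν s * π s a * nextVar P v s a) * √(ν s * π s a * ρ s a)) +
          11 * B * (ν s * π s a * ρ s a) := by
      intro s a
      by_cases h0 : ν s = 0
      · simp [h0]
      · have h3 := hρ s a h0 v hvB
        have e : √(ν s * π s a * nextVar P v s a) * √(ν s * π s a * ρ s a) =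
            ν s * π s a * √(nextVar P v s a * ρ s a) := by
          rw [← Real.sqrt_mul (mul_nonneg (hω s a) (hvar0 s a))]
          rw [show ν s * π s a * nextVar P v s a * (ν s * π s a * ρ s a) =
            (ν s * π s a) ^ 2 * (nextVar P v s a * ρ s a) by ring,
            Real.sqrt_mul (sq_nonneg _), Real.sqrt_sq (hω s a)]
        rw [mul_assoc M.γ, e, abs_mul, abs_of_nonneg hγ0]
        have h4 := mul_le_mul_of_nonneg_left h3 (mul_nonneg (hω s a) hγ0)
        have h5 : 0 ≤ 11 * B * (ν s * π s a * ρ s a) := by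
          have := mul_nonneg (hω s a) (hρ0 s a); positivity
        nlinarith
    have hcs : ∑ s, ∑ a, M.γ * √(ν s * π s a * nextVar P v s a) * √(ν s * π s a * ρ s a) ≤
        √(V * Ξ) := by
      refine Real.le_sqrt_of_sq_le ?_
      have h3 := Finset.sum_mul_sq_le_sq_mul_sq (Finset.univ : Finset (S × A))
        (fun z => M.γ * √(ν z.1 * π z.1 z.2 * nextVar P v z.1 z.2))
        (fun z => √(ν z.1 * π z.1 z.2 * ρ z.1 z.2))
      rw [Fintype.sum_prod_type, Fintype.sum_prod_type, Fintype.sum_prod_type] at h3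
      refine h3.trans (le_of_eq ?_)
      rw [hV, hΞ]
      refine congrArg₂ (· * ·) ?_ ?_
      · rw [Finset.mul_sum]
        refine Finset.sum_congr rfl fun s _ => ?_
        rw [Finset.mul_sum]
        refine Finset.sum_congr rfl fun a _ => ?_
        rw [mul_pow, Real.sq_sqrt (mul_nonneg (hω s a) (hvar0 s a))]
      · refine Finset.sum_congr rfl fun s _ => Finset.sum_congr rfl fun a _ => ?_
        rw [Real.sq_sqrt (mul_nonneg (hω s a) (hρ0 s a))]
    calc X ≤ ∑ s, ∑ a, (4 * (M.γ * √(ν s * π s a * nextVar P v s a) * √(ν s * π s a * ρ s a)) +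
          11 * B * (ν s * π s a * ρ s a)) :=
          Finset.sum_le_sum fun s _ => Finset.sum_le_sum fun a _ => hpt s a
      _ = 4 * ∑ s, ∑ a, M.γ * √(ν s * π s a * nextVar P v s a) * √(ν s * π s a * ρ s a) +
          11 * B * Ξ := by
          simp_rw [Finset.sum_add_distrib, ← Finset.mul_sum]
          rfl
      _ ≤ _ := by linarith
  exact hdiff.trans (le_of_self_bounding hX0 hΞ0 hε hXle (sum_nextVar_le hν0 hν hf hv hvB) h1 h2)

/-! ### Existence of optimal solutions -/

theorem continuous_value (M : SICMDP S A m) {f : S → A → ℝ}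
    (hf : ∀ s a, f s a ∈ Icc (0 : ℝ) 1) :
    Continuous fun z : TransitionKernel S A × StationaryPolicy S A => M.value z.1 z.2 f := by
  have hP : ∀ s a s', Continuous fun z : TransitionKernel S A × StationaryPolicy S A =>
      z.1 s a s' := fun s a s' => (continuous_apply s').comp (continuous_subtype_val.comp
        ((continuous_apply a).comp ((continuous_apply s).comp continuous_fst)))
  have hπ : ∀ s a, Continuous fun z : TransitionKernel S A × StationaryPolicy S A =>
      z.2 s a := fun s a => (continuous_apply a).comp (continuous_subtype_val.comp
        ((continuous_apply s).comp continuous_snd))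
  have hst : ∀ t s, Continuous fun z : TransitionKernel S A × StationaryPolicy S A =>
      M.stateProb z.1 z.2 t s := by
    intro t
    induction t with
    | zero => exact fun s => continuous_const
    | succ t ih =>
      exact fun s' => continuous_finsetSum _ fun s _ => continuous_finsetSum _ fun a _ =>
        ((ih s).mul (hπ s a)).mul (hP s a s')
  refine continuous_tsum (u := fun t : ℕ => M.γ ^ t) (fun t => ?_)
    (summable_geometric_of_lt_one M.γ_nonneg M.γ_lt_one) (fun t z => ?_)
  · exact continuous_const.mul (continuous_finsetSum _ fun s _ => continuous_finsetSum _ fun a _ =>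
      ((hst t s).mul (hπ s a)).mul continuous_const)
  · have hω : ∀ s a, 0 ≤ M.stateProb z.1 z.2 t s * z.2 s a := fun s a =>
      mul_nonneg (M.stateProb_nonneg _ _ _ _) (stdSimplex.zero_le _ _)
    have h0 : 0 ≤ ∑ s, ∑ a, M.stateProb z.1 z.2 t s * z.2 s a * f s a :=
      Finset.sum_nonneg fun s _ => Finset.sum_nonneg fun a _ => mul_nonneg (hω s a) (hf s a).1
    rw [Real.norm_eq_abs, abs_of_nonneg (mul_nonneg (pow_nonneg M.γ_nonneg t) h0)]
    refine mul_le_of_le_one_right (pow_nonneg M.γ_nonneg t) ?_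
    rw [← M.sum_stateProb z.1 z.2 t, ← sum_weight_policy z.2 (M.stateProb z.1 z.2 t)]
    exact Finset.sum_le_sum fun s _ => Finset.sum_le_sum fun a _ =>
      mul_le_of_le_one_right (hω s a) (hf s a).2

/-- The optimistic planning problem has a solution as soon as it has a feasible point, by
compactness. -/
theorem exists_isOptimisticSolution (M : SICMDP S A m) {K : Set (TransitionKernel S A)}
    (hK : IsClosed K) {P : TransitionKernel S A} (hP : P ∈ K) {π : StationaryPolicy S A}
    (hπ : M.Feasible P π) : ∃ z, M.IsOptimisticSolution K z := by
  set F : Set (TransitionKernel S A × StationaryPolicy S A) :=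
    {z | z.1 ∈ K} ∩ {z | M.Feasible z.1 z.2} with hF
  have hFc : IsClosed F := by
    refine (hK.preimage continuous_fst).inter ?_
    simp only [Feasible, ofPred_forall]
    exact isClosed_iInter fun y => isClosed_le (M.continuous_value (M.c_mem y)) continuous_const
  obtain ⟨z, hz, hmax⟩ := hFc.isCompact.exists_isMaxOn ⟨(P, π), hP, hπ⟩
    (M.continuous_value M.r_mem).continuousOn
  exact ⟨z, hz.1, hz.2, fun P' hP' π' hπ' => hmax (a := (P', π')) ⟨hP', hπ'⟩⟩

end Occupancy

/-! ### The vertices of the trees -/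

theorem treeDepth_pos (S : Type*) [Fintype S] : 0 < treeDepth S :=
  lt_of_lt_of_le Nat.one_pos (le_max_left _ _)

theorem card_le_two_pow_treeDepth (S : Type*) [Fintype S] :
    Fintype.card S ≤ 2 ^ treeDepth S :=
  (Nat.le_pow_clog one_lt_two _).trans (Nat.pow_le_pow_right two_pos (le_max_right _ _))

theorem two_pow_treeDepth_le (S : Type*) [Fintype S] [Nonempty S] :
    2 ^ treeDepth S ≤ 2 * Fintype.card S := by
  have hS : 0 < Fintype.card S := Fintype.card_pos
  unfold treeDepth
  rcases Nat.lt_or_ge 1 (Fintype.card S) with h | h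
  · have h1 := Nat.pow_pred_clog_lt_self one_lt_two h
    have h2 : 0 < Nat.clog 2 (Fintype.card S) := Nat.clog_pos one_lt_two h
    rw [max_eq_right (by omega)]
    calc 2 ^ Nat.clog 2 (Fintype.card S) = 2 * 2 ^ (Nat.clog 2 (Fintype.card S)).pred := by
          rw [← pow_succ', Nat.pred_eq_sub_one, Nat.sub_add_cancel h2]
      _ ≤ _ := by omega
  · have : Fintype.card S = 1 := by omega
    simp [this]

/-- The tree nodes are numbered like a binary heap, by `2 ^ j + k` for the `k`-th node at
depth `j`; the number `1` belongs to the root. -/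
theorem card_treeNode_le (S : Type*) [Fintype S] [Nonempty S] :
    Fintype.card (TreeNode S) + 2 ≤ 2 * Fintype.card S := by
  have hk : ∀ q : TreeNode S, (q.1.2 : ℕ) < 2 ^ (q.1.1 : ℕ) := fun q => by
    have h1 := q.2.2.trans_le (card_le_two_pow_treeDepth S)
    have h2 : (q.1.1 : ℕ) + (treeDepth S - q.1.1) = treeDepth S := by have := q.1.1.2; omega
    have h3 : 2 ^ treeDepth S = 2 ^ (q.1.1 : ℕ) * 2 ^ (treeDepth S - q.1.1) := by
      rw [← pow_add, h2]
    exact lt_of_mul_lt_mul_right (h1.trans_eq h3) (Nat.zero_le _)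
  have hlog : ∀ q : TreeNode S, Nat.log 2 (2 ^ (q.1.1 : ℕ) + q.1.2) = q.1.1 := fun q =>
    Nat.log_eq_of_pow_le_of_lt_pow (by omega) (by have := hk q; rw [pow_succ]; omega)
  have h := Finset.card_le_card_of_injOn (s := (Finset.univ : Finset (TreeNode S)))
    (t := Finset.Ico 2 (2 ^ treeDepth S)) 
    (fun q : TreeNode S => 2 ^ (q.1.1 : ℕ) + (q.1.2 : ℕ)) (fun q _ => by
      have h1 : 2 ^ 1 ≤ 2 ^ (q.1.1 : ℕ) := Nat.pow_le_pow_right two_pos q.2.1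
      have h2 : 2 ^ ((q.1.1 : ℕ) + 1) ≤ 2 ^ treeDepth S :=
        Nat.pow_le_pow_right two_pos q.1.1.2
      have h3 := hk q
      rw [pow_succ] at h2
      simp only [Finset.coe_Ico, mem_Ico]
      omega) (fun q _ q' _ hqq => by
      simp only at hqq
      have h1 : (q.1.1 : ℕ) = q'.1.1 := by rw [← hlog q, ← hlog q', hqq]
      rw [h1] at hqq
      exact Subtype.ext (Prod.ext (Fin.ext h1) (Fin.ext (by omega))))
  rw [Finset.card_univ, Nat.card_Ico] at h
  have h2 := two_pow_treeDepth_le S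
  have h3 : 2 ^ 1 ≤ 2 ^ treeDepth S := Nat.pow_le_pow_right two_pos (treeDepth_pos S)
  omega

section Tree

variable {S A : Type*} [Fintype S]

/-- The pair `(s, a)` in whose tree a step from `x` under the action `b` takes place. -/
def treeOf : AugState S A → A → S × A
  | Sum.inl s, b => (s, b)
  | Sum.inr (s, a, _), _ => (s, a)

/-- The depth of `x` in its tree; original states count as roots. -/
def depthOf : AugState S A → ℕ
  | Sum.inl _ => 0
  | Sum.inr (_, _, q) => q.1.1

/-- The index of `x` among the vertices of its depth. -/
def indexOf : AugState S A → ℕ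
  | Sum.inl _ => 0
  | Sum.inr (_, _, q) => q.1.2

/-- The leaves below `x`. -/
def leaves (e : S ≃ Fin (Fintype.card S)) (x : AugState S A) : Finset S :=
  Finset.univ.filter fun s' => ancestor e (depthOf x) s' = indexOf x

/-- The child of `x` (under the action `b`) on the way to the leaf `s'`. -/
def child (e : S ≃ Fin (Fintype.card S)) (x : AugState S A) (b : A) (s' : S) : AugState S A :=
  pathVertex e (treeOf x b).1 (treeOf x b).2 s' (depthOf x + 1)

theorem mem_leaves {e : S ≃ Fin (Fintype.card S)} {x : AugState S A} {s' : S} :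
    s' ∈ leaves e x ↔ ancestor e (depthOf x) s' = indexOf x := by simp [leaves]

theorem depthOf_lt (x : AugState S A) : depthOf x < treeDepth S := by
  rcases x with s | ⟨s, a, q⟩
  · exact treeDepth_pos S
  · exact q.1.1.2

theorem ancestor_zero (e : S ≃ Fin (Fintype.card S)) (s' : S) : ancestor e 0 s' = 0 :=
  Nat.div_eq_of_lt ((e s').2.trans_le (card_le_two_pow_treeDepth S))

theorem leaves_inl (e : S ≃ Fin (Fintype.card S)) (s : S) :
    leaves e (Sum.inl s : AugState S A) = Finset.univ := by
  ext s'
  simp [mem_leaves, depthOf, indexOf, ancestor_zero]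

theorem leaves_nonempty (e : S ≃ Fin (Fintype.card S)) (x : AugState S A) :
    (leaves e x).Nonempty := by
  rcases x with s | ⟨s, a, q⟩
  · exact ⟨s, by simp [leaves_inl]⟩
  · refine ⟨e.symm ⟨_, q.2.2⟩, ?_⟩
    simp [mem_leaves, depthOf, indexOf, ancestor]

theorem augStep_iff (e : S ≃ Fin (Fintype.card S)) (x : AugState S A) (b : A) (s : S) (a : A)
    (s' : S) (x' : AugState S A) :
    AugStep e x b s a s' x' ↔ (s, a) = treeOf x b ∧ s' ∈ leaves e x ∧ child e x b s' = x' := by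
  rcases x with t | ⟨t, b', q⟩
  · simp only [AugStep, treeOf, leaves_inl, Finset.mem_univ, true_and, child, depthOf,
      Prod.mk.injEq]
    constructor
    · rintro ⟨rfl, rfl, rfl⟩; exact ⟨⟨rfl, rfl⟩, rfl⟩
    · rintro ⟨⟨rfl, rfl⟩, rfl⟩; exact ⟨rfl, rfl, rfl⟩
  · simp only [AugStep, treeOf, mem_leaves, child,
      depthOf, indexOf, Prod.mk.injEq]
    constructor
    · rintro ⟨rfl, rfl, h, rfl⟩; exact ⟨⟨rfl, rfl⟩, h, rfl⟩
    · rintro ⟨⟨rfl, rfl⟩, h, rfl⟩; exact ⟨rfl, rfl, h, rfl⟩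

theorem mem_augSupp_iff (e : S ≃ Fin (Fintype.card S)) (x : AugState S A) (b : A)
    (x' : AugState S A) : x' ∈ augSupp e x b ↔ ∃ s' ∈ leaves e x, child e x b s' = x' := by
  constructor
  · rintro ⟨s, a, s', h⟩
    exact ⟨s', ((augStep_iff ..).mp h).2⟩
  · rintro ⟨s', h⟩
    exact ⟨(treeOf x b).1, (treeOf x b).2, s', (augStep_iff ..).mpr ⟨rfl, h⟩⟩

theorem ancestor_succ_div_two (e : S ≃ Fin (Fintype.card S)) {j : ℕ} (hj : j < treeDepth S)
    (s' : S) : ancestor e (j + 1) s' / 2 = ancestor e j s' := by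
  unfold ancestor
  rw [Nat.div_div_eq_div_mul, ← pow_succ]
  congr 2
  omega

theorem pathVertex_congr (e : S ≃ Fin (Fintype.card S)) (s : S) (a : A) {s' s'' : S} {j : ℕ}
    (hj0 : 0 < j) (hj : j ≤ treeDepth S) (h : ancestor e j s' = ancestor e j s'') :
    pathVertex e s a s' j = pathVertex e s a s'' j := by
  unfold pathVertex
  split_ifs with h1
  · simp [h]
  · have hjd : j = treeDepth S := by omega
    subst hjd
    simp only [ancestor, Nat.sub_self, pow_zero, Nat.div_one] at h
    rw [e.injective (Fin.ext h)]

/-- Every vertex has at most two children. -/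
theorem exists_two_children (e : S ≃ Fin (Fintype.card S)) (x : AugState S A) (b : A) :
    ∃ c₀ c₁ : AugState S A, ∀ s' ∈ leaves e x, child e x b s' = c₀ ∨ child e x b s' = c₁ := by
  classical
  obtain ⟨s₀, hs₀⟩ := leaves_nonempty e x
  have hd := depthOf_lt x
  have hanc : ∀ s' ∈ leaves e x, ancestor e (depthOf x + 1) s' / 2 = indexOf x := fun s' hs' => by
    rw [ancestor_succ_div_two e hd]
    exact mem_leaves.mp hs'
  have hchild : ∀ s' s'', ancestor e (depthOf x + 1) s' = ancestor e (depthOf x + 1) s'' →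
      child e x b s' = child e x b s'' := fun s' s'' h =>
    pathVertex_congr e _ _ (Nat.succ_pos _) hd h
  by_cases h : ∀ s' ∈ leaves e x, child e x b s' = child e x b s₀
  · exact ⟨child e x b s₀, child e x b s₀, fun s' hs' => Or.inl (h s' hs')⟩
  · push Not at h
    obtain ⟨s₁, hs₁, hne⟩ := h
    refine ⟨child e x b s₀, child e x b s₁, fun s' hs' => ?_⟩
    have h0 := hanc s₀ hs₀
    have h1 := hanc s₁ hs₁
    have h2 := hanc s' hs'
    have h3 : ancestor e (depthOf x + 1) s₁ ≠ ancestor e (depthOf x + 1) s₀ := fun h =>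
      hne (hchild _ _ h)
    by_cases h4 : ancestor e (depthOf x + 1) s' = ancestor e (depthOf x + 1) s₀
    · exact Or.inl (hchild _ _ h4)
    · exact Or.inr (hchild _ _ (by omega))

theorem pathVertex_eq_inl_iff (e : S ≃ Fin (Fintype.card S)) (s : S) (a : A) (s' t : S) {j : ℕ}
    (hj0 : 0 < j) (hj : j ≤ treeDepth S) :
    pathVertex e s a s' j = Sum.inl t ↔ j = treeDepth S ∧ s' = t := by
  unfold pathVertex
  split_ifs with h1
  · simp only [false_iff, not_and]; omega
  · simp only [Sum.inl.injEq, iff_and_self]; omega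

theorem pathVertex_eq_inr_iff (e : S ≃ Fin (Fintype.card S)) (s : S) (a : A) (s' : S) {j : ℕ}
    (hj0 : 0 < j) (t : S) (b : A) (q : TreeNode S) :
    pathVertex e s a s' j = Sum.inr (t, b, q) ↔
      j = q.1.1 ∧ s = t ∧ a = b ∧ ancestor e q.1.1 s' = q.1.2 := by
  obtain ⟨⟨⟨i, hi⟩, ⟨k, hk⟩⟩, hq⟩ := q
  unfold pathVertex
  split_ifs with h1
  · simp only [Sum.inr.injEq, Prod.mk.injEq, Subtype.mk.injEq, Fin.mk.injEq]
    constructor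
    · rintro ⟨rfl, rfl, rfl, rfl⟩; exact ⟨rfl, rfl, rfl, rfl⟩
    · rintro ⟨rfl, rfl, rfl, rfl⟩; exact ⟨rfl, rfl, rfl, rfl⟩
  · simp only [false_iff, not_and]
    intro h
    exact (h1 ⟨hj0, h ▸ hi⟩).elim

/-- A leaf has exactly one ancestor at each depth. -/
theorem sum_treeNode_ancestor (e : S ≃ Fin (Fintype.card S)) (s' : S) (F : ℕ → ℝ) :
    ∑ q : TreeNode S, (if ancestor e q.1.1 s' = (q.1.2 : ℕ) then F q.1.1 else 0) =
      ∑ j ∈ Finset.Ico 1 (treeDepth S), F j := by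
  rw [← Finset.sum_filter]
  refine Finset.sum_bij (fun q _ => (q.1.1 : ℕ)) (fun q _ => ?_) (fun q hq q' hq' h => ?_)
    (fun j hj => ?_) (fun q _ => rfl)
  · rw [Finset.mem_Ico]; exact ⟨q.2.1, q.1.1.2⟩
  · rw [Finset.mem_filter] at hq hq'
    refine Subtype.ext (Prod.ext (Fin.ext h) (Fin.ext ?_))
    rw [← hq.2, ← hq'.2, h]
  · rw [Finset.mem_Ico] at hj
    exact ⟨⟨(⟨j, hj.2⟩, ⟨ancestor e j s', ancestor_lt e j s'⟩), hj.1, ancestor_mul_lt e j s'⟩,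
      by simp, rfl⟩

end Tree

/-! ### The true dynamics of the augmented problem -/

section AugKernel

variable {S A : Type*} [Fintype S]

/-- The probability that a transition under `P` passes through `x`, when it starts in the root of
the tree of `x`. -/
def reach (e : S ≃ Fin (Fintype.card S)) (P : TransitionKernel S A) (x : AugState S A) (b : A) :
    ℝ :=
  ∑ s' ∈ leaves e x, P (treeOf x b).1 (treeOf x b).2 s'

theorem reach_nonneg (e : S ≃ Fin (Fintype.card S)) (P : TransitionKernel S A)
    (x : AugState S A) (b : A) : 0 ≤ reach e P x b :=
  Finset.sum_nonneg fun _ _ => stdSimplex.zero_le _ _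

theorem reach_inl (e : S ≃ Fin (Fintype.card S)) (P : TransitionKernel S A) (s : S) (b : A) :
    reach e P (Sum.inl s) b = 1 := by
  rw [reach, leaves_inl]
  exact stdSimplex.sum_eq_one _

theorem augment_γ_pow [Fintype A] {m : ℕ} (M : SICMDP S A m) : M.augment.γ ^ treeDepth S = M.γ := by
  change (M.γ ^ (1 / (treeDepth S : ℝ))) ^ treeDepth S = M.γ
  rw [one_div]
  exact Real.rpow_inv_natCast_pow M.γ_nonneg (treeDepth_pos S).ne'

section Flow

variable [Fintype A] {m : ℕ}

/-- The occupancy measure of the augmented problem under its true dynamics, expressed through an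
occupancy measure `ν` of the original problem. -/
noncomputable def augFlow (M : SICMDP S A m) (e : S ≃ Fin (Fintype.card S))
    (P : TransitionKernel S A) (π : StationaryPolicy S A) (ν : S → ℝ) : AugState S A → ℝ
  | Sum.inl s => ν s
  | Sum.inr (s, a, q) => M.augment.γ ^ (q.1.1 : ℕ) * (ν s * π s a) *
      reach e P (Sum.inr (s, a, q)) a

theorem augFlow_nonneg (M : SICMDP S A m) (e : S ≃ Fin (Fintype.card S))
    (P : TransitionKernel S A) (π : StationaryPolicy S A) {ν : S → ℝ} (hν : ∀ s, 0 ≤ ν s)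
    (x : AugState S A) : 0 ≤ augFlow M e P π ν x := by
  rcases x with s | ⟨s, a, q⟩
  · exact hν s
  · exact mul_nonneg (mul_nonneg (pow_nonneg M.augment.γ_nonneg _)
      (mul_nonneg (hν s) (stdSimplex.zero_le _ _))) (reach_nonneg _ _ _ _)

end Flow

variable [Fintype A] [DecidableEq S] [DecidableEq A] {m : ℕ}

/-- The leaves below `x` that are reached through the child `x'`. -/
def fiber (e : S ≃ Fin (Fintype.card S)) (x : AugState S A) (b : A) (x' : AugState S A) :
    Finset S :=
  (leaves e x).filter fun s' => child e x b s' = x'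

/-- `Q` is a version of the true dynamics of the augmented problem: `Q x b x'` is the conditional
probability, given that the walk through the tree passes through `x`, that it goes on to `x'`.
If `x` is reached with probability `0`, then `Q x b` may be any law on the children of `x`. -/
def IsAugKernel (e : S ≃ Fin (Fintype.card S)) (P : TransitionKernel S A)
    (Q : TransitionKernel (AugState S A) A) : Prop :=
  (∀ x b x', x' ∉ augSupp e x b → Q x b x' = 0) ∧
    ∀ x b x', ∑ s' ∈ fiber e x b x', P (treeOf x b).1 (treeOf x b).2 s' =
      Q x b x' * reach e P x b

theorem exists_isAugKernel (e : S ≃ Fin (Fintype.card S)) (P : TransitionKernel S A) :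
    ∃ Q, IsAugKernel e P Q := by
  have key : ∀ x b, ∃ p : stdSimplex ℝ (AugState S A), (∀ x', x' ∉ augSupp e x b → p x' = 0) ∧
      ∀ x', ∑ s' ∈ fiber e x b x', P (treeOf x b).1 (treeOf x b).2 s' = p x' * reach e P x b := by
    intro x b
    set w := P (treeOf x b).1 (treeOf x b).2 with hw
    have hfib0 : ∀ x', 0 ≤ ∑ s' ∈ fiber e x b x', w s' := fun x' =>
      Finset.sum_nonneg fun _ _ => stdSimplex.zero_le _ _
    have hfib : ∑ x', ∑ s' ∈ fiber e x b x', w s' = reach e P x b := Finset.sum_fiberwise _ _ _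
    by_cases hR : reach e P x b = 0
    · obtain ⟨s₀, hs₀⟩ := leaves_nonempty e x
      refine ⟨⟨Pi.single (child e x b s₀) 1, single_mem_stdSimplex _ _⟩, fun x' hx' => ?_,
        fun x' => ?_⟩
      · refine Pi.single_eq_of_ne ?_ _
        rintro rfl
        exact hx' ((mem_augSupp_iff ..).mpr ⟨s₀, hs₀, rfl⟩)
      · rw [hR, mul_zero]
        refine le_antisymm ?_ (hfib0 x')
        rw [← hR, ← hfib]
        exact Finset.single_le_sum (fun x' _ => hfib0 x') (Finset.mem_univ x')
    · refine ⟨⟨fun x' => (∑ s' ∈ fiber e x b x', w s') / reach e P x b,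
        fun x' => div_nonneg (hfib0 x') (reach_nonneg e P x b), ?_⟩, fun x' hx' => ?_, fun x' => ?_⟩
      · rw [← Finset.sum_div, hfib, div_self hR]
      · have : fiber e x b x' = ∅ := by
          rw [fiber, Finset.filter_eq_empty_iff]
          exact fun s' hs' h => hx' ((mem_augSupp_iff ..).mpr ⟨s', hs', h⟩)
        change (∑ s' ∈ fiber e x b x', w s') / reach e P x b = 0
        rw [this]; simp
      · change _ = (∑ s' ∈ fiber e x b x', w s') / reach e P x b * reach e P x b
        rw [div_mul_cancel₀ _ hR]
  choose Q hQ using key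
  exact ⟨Q, fun x b => (hQ x b).1, fun x b => (hQ x b).2⟩

/-- The flow equation for `augFlow`.  During one original transition `(s, a, s')`, the augmented
process visits the vertex of the path at depth `j` with the discount `γ ^ (j / d)`, so that both
sides are sums over the original transitions. -/
theorem isFlow_augFlow (M : SICMDP S A m) (e : S ≃ Fin (Fintype.card S))
    {P : TransitionKernel S A} {Q : TransitionKernel (AugState S A) A} (hQ : IsAugKernel e P Q)
    (π : StationaryPolicy (AugState S A) A) {ν : S → ℝ}
    (hν : M.IsFlow P (fun s => π (Sum.inl s)) ν) :
    M.augment.IsFlow Q π (augFlow M e P (fun s => π (Sum.inl s)) ν) := by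
  intro x'
  set g := M.augment.γ with hg
  set d := treeDepth S with hd
  have hd0 : 0 < d := treeDepth_pos S
  have hgd : g ^ d = M.γ := M.augment_γ_pow
  set ω : S → A → ℝ := fun s a => ν s * π (Sum.inl s) a with hω
  have hroot : ∀ s b, Q (Sum.inl s) b x' =
      ∑ s', P s b s' * if pathVertex e s b s' 1 = x' then 1 else 0 := fun s b => by
    have := hQ.2 (Sum.inl s) b x'
    rw [reach_inl, mul_one] at this
    rw [← this, fiber, leaves_inl, Finset.sum_filter]
    exact Finset.sum_congr rfl fun s' _ => by simp [child, treeOf, depthOf]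
  have hnode : ∀ s a q b, augFlow M e P (fun s => π (Sum.inl s)) ν (Sum.inr (s, a, q)) *
      Q (Sum.inr (s, a, q)) b x' = ω s a * ∑ s', P s a s' *
        if ancestor e q.1.1 s' = (q.1.2 : ℕ) then
          g ^ (q.1.1 : ℕ) * (if pathVertex e s a s' (q.1.1 + 1) = x' then 1 else 0)
        else 0 := fun s a q b => by
    have h := hQ.2 (Sum.inr (s, a, q)) b x'
    have hr : reach e P (Sum.inr (s, a, q)) a = reach e P (Sum.inr (s, a, q)) b := rfl
    calc _ = g ^ (q.1.1 : ℕ) * ω s a *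
          (Q (Sum.inr (s, a, q)) b x' * reach e P (Sum.inr (s, a, q)) b) := by
          rw [augFlow, hr, ← hg, hω]; ring
      _ = _ := by
          rw [← h, fiber, leaves, Finset.filter_filter, Finset.sum_filter, Finset.mul_sum,
            Finset.mul_sum]
          refine Finset.sum_congr rfl fun s' _ => ?_
          simp only [child, treeOf, depthOf, indexOf]
          by_cases h1 : ancestor e q.1.1 s' = (q.1.2 : ℕ) <;>
            by_cases h2 : pathVertex e s a s' (q.1.1 + 1) = x' <;> simp [h1, h2]
          ring
  -- the expected discounted number of visits of `x'` during one original transition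
  set H : S → A → S → ℝ := fun s a s' => ∑ j ∈ Finset.range d,
    g ^ j * if pathVertex e s a s' (j + 1) = x' then 1 else 0 with hH
  have htot : ∑ x, ∑ b, augFlow M e P (fun s => π (Sum.inl s)) ν x * π x b * Q x b x' =
      ∑ s, ∑ a, ω s a * ∑ s', P s a s' * H s a s' := by
    rw [Fintype.sum_sum_type, Fintype.sum_prod_type]
    simp_rw [Fintype.sum_prod_type]
    rw [← Finset.sum_add_distrib]
    refine Finset.sum_congr rfl fun s _ => ?_
    rw [← Finset.sum_add_distrib]
    refine Finset.sum_congr rfl fun a _ => ?_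
    have e1 : ∀ q : TreeNode S, ∑ b, augFlow M e P (fun s => π (Sum.inl s)) ν (Sum.inr (s, a, q)) *
        π (Sum.inr (s, a, q)) b * Q (Sum.inr (s, a, q)) b x' = ω s a * ∑ s', P s a s' *
        if ancestor e q.1.1 s' = (q.1.2 : ℕ) then
          g ^ (q.1.1 : ℕ) * (if pathVertex e s a s' (q.1.1 + 1) = x' then 1 else 0)
        else 0 := fun q => by
      calc _ = ∑ b, π (Sum.inr (s, a, q)) b * (ω s a * ∑ s', P s a s' *
          if ancestor e q.1.1 s' = (q.1.2 : ℕ) then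
            g ^ (q.1.1 : ℕ) * (if pathVertex e s a s' (q.1.1 + 1) = x' then 1 else 0)
          else 0) := Finset.sum_congr rfl fun b _ => by rw [← hnode s a q b]; ring
        _ = _ := by rw [← Finset.sum_mul, stdSimplex.sum_eq_one, one_mul]
    rw [Finset.sum_congr rfl fun q _ => e1 q, ← Finset.mul_sum, Finset.sum_comm, hroot]
    change ω s a * _ + _ = _
    rw [← mul_add, ← Finset.sum_add_distrib]
    congr 1
    refine Finset.sum_congr rfl fun s' _ => ?_
    rw [← Finset.mul_sum, ← mul_add, sum_treeNode_ancestor e s'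
      (fun j => g ^ j * (if pathVertex e s a s' (j + 1) = x' then 1 else 0)), hH]
    simp only
    rw [Finset.range_eq_Ico, Finset.sum_eq_sum_Ico_succ_bot hd0]
    simp [hd]
  have hgtot : g * ∑ s, ∑ a, ω s a * ∑ s', P s a s' * H s a s' =
      ∑ s, ∑ a, ω s a * ∑ s', P s a s' * (g * H s a s') := by
    simp_rw [Finset.mul_sum]
    exact Finset.sum_congr rfl fun s _ => Finset.sum_congr rfl fun a _ =>
      Finset.sum_congr rfl fun s' _ => by ring
  rw [htot, hgtot]
  rcases x' with t | ⟨t, b, q⟩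
  · have hHt : ∀ s a s', g * H s a s' = if s' = t then M.γ else 0 := fun s a s' => by
      rw [hH]
      simp only
      rw [Finset.sum_eq_single (d - 1)]
      · have h1 := pathVertex_eq_inl_iff e s a s' t (j := d - 1 + 1) (Nat.succ_pos _) (by omega)
        have h2 : d - 1 + 1 = d := by omega
        rw [if_congr (h1.trans (and_iff_right (h2.trans hd))) rfl rfl, mul_ite, mul_one, mul_zero,
          mul_ite, mul_zero, ← pow_succ', h2, hgd]
      · intro j hj hne
        rw [Finset.mem_range] at hj
        have h1 := pathVertex_eq_inl_iff e s a s' t (j := j + 1) (Nat.succ_pos _) (by omega)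
        rw [if_neg (fun h => hne (by have := (h1.mp h).1; omega)), mul_zero]
      · intro h; simp at h; omega
    change ν t = M.μ t + _
    rw [hν t, Finset.mul_sum]
    congr 1
    refine Finset.sum_congr rfl fun s _ => ?_
    rw [Finset.mul_sum]
    refine Finset.sum_congr rfl fun a _ => ?_
    simp only [hHt, mul_ite, mul_zero, Finset.sum_ite_eq', Finset.mem_univ, if_true, hω]
    ring
  · have hHt : ∀ s a s', g * H s a s' = if s = t ∧ a = b then
        if ancestor e q.1.1 s' = (q.1.2 : ℕ) then g ^ (q.1.1 : ℕ) else 0 else 0 :=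
      fun s a s' => by
      have hq0 := q.2.1
      have hqd := q.1.1.2
      have h2 : (q.1.1 : ℕ) - 1 + 1 = q.1.1 := by omega
      rw [hH]
      simp only
      rw [Finset.sum_eq_single ((q.1.1 : ℕ) - 1)]
      · have h1 := pathVertex_eq_inr_iff e s a s' (j := (q.1.1 : ℕ) - 1 + 1) (Nat.succ_pos _) t b q
        rw [if_congr (h1.trans (and_iff_right h2)) rfl rfl, ← mul_assoc, ← pow_succ', h2]
        by_cases h3 : s = t <;> by_cases h4 : a = b <;> simp [h3, h4]
      · intro j hj hne
        have h1 := pathVertex_eq_inr_iff e s a s' (j := j + 1) (Nat.succ_pos _) t b q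
        rw [if_neg (fun h => hne (by have := (h1.mp h).1; omega)), mul_zero]
      · intro h; simp at h; omega
    change _ = 0 + _
    rw [zero_add, Finset.sum_eq_single t, Finset.sum_eq_single b]
    · have h1 : ∀ s', P t b s' * (g * H t b s') = g ^ (q.1.1 : ℕ) *
          if ancestor e q.1.1 s' = (q.1.2 : ℕ) then P t b s' else 0 := fun s' => by
        rw [hHt, if_pos ⟨rfl, rfl⟩]
        split_ifs <;> ring
      rw [augFlow, ← hg, Finset.sum_congr rfl fun s' _ => h1 s', ← Finset.mul_sum,
        ← Finset.sum_filter]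
      change _ * ω t b * (∑ s' ∈ leaves e (Sum.inr (t, b, q) : AugState S A), P t b s') =
        ω t b * (_ * ∑ s' ∈ leaves e (Sum.inr (t, b, q) : AugState S A), P t b s')
      ring
    · intro a _ ha
      simp [hHt, ha]
    · simp
    · intro s _ hs
      simp [hHt, hs]
    · simp

/-- Under the true dynamics, the augmented problem assigns to every policy the value of its
restriction to the original states. -/
theorem value_augment (M : SICMDP S A m) (e : S ≃ Fin (Fintype.card S))
    {P : TransitionKernel S A} {Q : TransitionKernel (AugState S A) A} (hQ : IsAugKernel e P Q)
    (π : StationaryPolicy (AugState S A) A) {f : S → A → ℝ}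
    (hf : ∀ s a, f s a ∈ Icc (0 : ℝ) 1) :
    M.augment.value Q π (fun x a => Sum.elim (fun s => f s a) (fun _ => 0) x) =
      M.value P (fun s => π (Sum.inl s)) f := by
  rw [M.augment.value_eq_of_isFlow Q π (fun x a => ?_)
    (isFlow_augFlow M e hQ π (M.isFlow_occupancy P _)), M.value_eq_occupancy,
    Fintype.sum_sum_type]
  · simp [augFlow]
  · rcases x with s | z
    · exact hf s a
    · simp

end AugKernel

/-! ### The confidence sets of the augmented problem -/

theorem sum_mul_eq_of_two_point {X : Type*} [Fintype X] (p : stdSimplex ℝ X) {c₀ c₁ : X}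
    (h : ∀ x, x ≠ c₀ → x ≠ c₁ → p x = 0) (v : X → ℝ) :
    ∑ x, p x * v x = p c₀ * v c₀ + (1 - p c₀) * v c₁ := by
  have h1 : ∑ x, p x * (v x - v c₁) = p c₀ * (v c₀ - v c₁) := by
    refine Finset.sum_eq_single c₀ (fun x _ hx => ?_) (by simp)
    by_cases hx1 : x = c₁
    · simp [hx1]
    · simp [h x hx hx1]
  simp_rw [mul_sub, Finset.sum_sub_distrib] at h1
  rw [← Finset.sum_mul, stdSimplex.sum_eq_one] at h1
  linarith

theorem apply_eq_of_two_point {X : Type*} [Fintype X] (p : stdSimplex ℝ X) {c₀ c₁ : X}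
    (h : ∀ x, x ≠ c₀ → x ≠ c₁ → p x = 0) (hne : c₀ ≠ c₁) : p c₁ = 1 - p c₀ := by
  classical
  have h1 := sum_mul_eq_of_two_point p h (fun x => if x = c₁ then 1 else 0)
  simpa [hne] using h1

/-- The estimate of the transition probabilities in terms of the variance of a value function. -/
theorem abs_sum_sub_le_of_two_point {T A : Type*} [Fintype T]
    {K K' : TransitionKernel T A}
    {x : T} {b : A} {c₀ c₁ : T} (hK : ∀ x', x' ≠ c₀ → x' ≠ c₁ → K x b x' = 0)
    (hK' : ∀ x', x' ≠ c₀ → x' ≠ c₁ → K' x b x' = 0) {ρ B : ℝ} (hρ : 0 ≤ ρ)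
    (h : |K' x b c₀ - K x b c₀| ≤ 4 * √(K x b c₀ * (1 - K x b c₀) * ρ) + 11 * ρ)
    {v : T → ℝ} (hv : ∀ s, v s ∈ Icc (0 : ℝ) B) :
    |∑ x', K' x b x' * v x' - ∑ x', K x b x' * v x'| ≤
      4 * √(nextVar K v x b * ρ) + 11 * B * ρ := by
  have hvar : nextVar K v x b = K x b c₀ * (1 - K x b c₀) * (v c₀ - v c₁) ^ 2 := by
    rw [nextVar, sum_mul_eq_of_two_point (K x b) hK v,
      sum_mul_eq_of_two_point (K x b) hK (fun y => v y ^ 2)]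
    ring
  have hΔ : |v c₀ - v c₁| ≤ B := abs_le.mpr
    ⟨by linarith [(hv c₀).1, (hv c₁).2], by linarith [(hv c₀).2, (hv c₁).1]⟩
  rw [sum_mul_eq_of_two_point (K x b) hK v, sum_mul_eq_of_two_point (K' x b) hK' v, hvar,
    show K' x b c₀ * v c₀ + (1 - K' x b c₀) * v c₁ - (K x b c₀ * v c₀ + (1 - K x b c₀) * v c₁) =
      (K' x b c₀ - K x b c₀) * (v c₀ - v c₁) by ring, abs_mul,
    show K x b c₀ * (1 - K x b c₀) * (v c₀ - v c₁) ^ 2 * ρ =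
      (v c₀ - v c₁) ^ 2 * (K x b c₀ * (1 - K x b c₀) * ρ) by ring,
    Real.sqrt_mul (sq_nonneg _), Real.sqrt_sq_eq_abs]
  have h1 := mul_le_mul_of_nonneg_right h (abs_nonneg (v c₀ - v c₁))
  have h2 := mul_le_mul_of_nonneg_right hΔ hρ
  linarith

/-- The counts of the samples in `G` and in `H ⊆ G` behave as expected, where `q` is the conditional
probability of `H` given `G` and `R` is the probability of `G`. -/
def GoodCounts {S : Type*} [DecidableEq S] (G H : Finset S) (q R L L₂ : ℝ) {n : ℕ}
    (ω : Fin n → S) : Prop :=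
  |(hits H ω : ℝ) - q * hits G ω| ≤ √(2 * (q * (1 - q)) * L * hits G ω) + L ∧
    |(hits H ω : ℝ) - q * hits G ω| ≤ √(L₂ * hits G ω / 2) ∧
    (8 * L < n * R → n * R / 2 ≤ hits G ω)

theorem iidProb_not_goodCounts_le {S : Type*} [Fintype S] [DecidableEq S] {p : S → ℝ}
    (hp0 : ∀ s, 0 ≤ p s) (hp1 : ∑ s, p s = 1) {G H : Finset S} (hHG : H ⊆ G) {q : ℝ}
    (hq : ∑ s ∈ H, p s = q * ∑ s ∈ G, p s) (hq0 : 0 ≤ q) (hq1 : q ≤ 1) {L L₂ : ℝ} (hL : 0 < L)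
    (hL₂ : 0 < L₂) (n : ℕ) :
    iidProb p n (fun ω => ¬ GoodCounts G H q (∑ s ∈ G, p s) L L₂ ω) ≤
      3 * Real.exp (-L) + 2 * Real.exp (-L₂) := by
  -- the lower tails for `H` are the upper tails for `G \ H`
  have hq' : ∑ s ∈ G \ H, p s = (1 - q) * ∑ s ∈ G, p s := by
    rw [← Finset.sum_sdiff hHG] at hq ⊢
    linarith
  have hsd : ∀ ω : Fin n → S, (hits (G \ H) ω : ℝ) - (1 - q) * hits G ω =
      -((hits H ω : ℝ) - q * hits G ω) := fun ω => by
    have : (hits (G \ H) ω : ℝ) + hits H ω = hits G ω := by exact_mod_cast hits_sdiff hHG ω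
    linarith
  have hsub : G \ H ⊆ G := Finset.sdiff_subset
  have b1 := iidProb_bernstein hp0 hp1 hHG hq hq0 hq1 hL n
  have b2 := iidProb_bernstein hp0 hp1 hsub hq' (by linarith) (by linarith) hL n
  have b3 := iidProb_hoeffding hp0 hp1 hHG hq hq0 hq1 hL₂ n
  have b4 := iidProb_hoeffding hp0 hp1 hsub hq' (by linarith) (by linarith) hL₂ n
  have b5 : iidProb p n (fun ω => 8 * L < n * (∑ s ∈ G, p s) ∧
      (hits G ω : ℝ) < n * (∑ s ∈ G, p s) / 2) ≤ Real.exp (-L) := by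
    by_cases h : 8 * L < n * (∑ s ∈ G, p s)
    · simpa [h] using iidProb_hits_lt hp0 hp1 G n h
    · simp [h, iidProb, iidExp, (Real.exp_pos _).le]
  simp_rw [hsd] at b2 b4
  refine (iidProb_mono hp0 (E' := fun ω =>
    (√(2 * (q * (1 - q)) * L * hits G ω) + L < hits H ω - q * hits G ω ∨
      √(2 * ((1 - q) * (1 - (1 - q))) * L * hits G ω) + L < -(hits H ω - q * hits G ω)) ∨
    (√(L₂ * hits G ω / 2) < hits H ω - q * hits G ω ∨
      √(L₂ * hits G ω / 2) < -(hits H ω - q * hits G ω)) ∨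
    (8 * L < n * (∑ s ∈ G, p s) ∧ (hits G ω : ℝ) < n * (∑ s ∈ G, p s) / 2))
    fun ω hω => ?_).trans ?_
  · by_contra hc
    push Not at hc
    obtain ⟨⟨h1, h2⟩, ⟨h3, h4⟩, h5⟩ := hc
    rw [show (1 - q) * (1 - (1 - q)) = q * (1 - q) by ring] at h2
    exact hω ⟨abs_le.mpr ⟨by linarith, h1⟩, abs_le.mpr ⟨by linarith, h3⟩, h5⟩
  · refine (iidProb_or_le hp0 _ _).trans ?_
    have c1 := (iidProb_or_le hp0 _ _).trans (add_le_add b1 b2)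
    have c2 := (iidProb_or_le hp0 _ _).trans (add_le_add ((iidProb_or_le hp0 _ _).trans
      (add_le_add b3 b4)) b5)
    linarith

theorem apply_eq_zero_of_children {S A : Type*} [Fintype S] [Fintype A]
    {e : S ≃ Fin (Fintype.card S)}
    {Q : TransitionKernel (AugState S A) A} (hQ : ∀ x b x', x' ∉ augSupp e x b → Q x b x' = 0)
    {x : AugState S A} {b : A} {c₀ c₁ : AugState S A}
    (hc : ∀ s' ∈ leaves e x, child e x b s' = c₀ ∨ child e x b s' = c₁) (x' : AugState S A)
    (h0 : x' ≠ c₀) (h1 : x' ≠ c₁) : Q x b x' = 0 := by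
  refine hQ x b x' fun h => ?_
  obtain ⟨s', hs', rfl⟩ := (mem_augSupp_iff ..).mp h
  rcases hc s' hs' with h | h
  · exact h0 h
  · exact h1 h

section AugCounts

variable {S A : Type*} [Fintype S] [DecidableEq S] [DecidableEq A]

theorem augCount_eq_hits (e : S ≃ Fin (Fintype.card S)) {n₀ : ℕ} (D : Dataset S A n₀)
    (x : AugState S A) (b : A) (x' : AugState S A) :
    augCount e D x b x' = hits (fiber e x b x') (D (treeOf x b).1 (treeOf x b).2) := by
  have h1 : hits (fiber e x b x') (D (treeOf x b).1 (treeOf x b).2) =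
      Nat.card {i : Fin n₀ // D (treeOf x b).1 (treeOf x b).2 i ∈ fiber e x b x'} := by
    rw [hits, Nat.card_eq_fintype_card, Fintype.card_subtype, Finset.card_filter]
  rw [h1, augCount]
  refine Nat.card_congr ⟨fun p => ⟨p.1.2.2, ?_⟩,
    fun i => ⟨((treeOf x b).1, (treeOf x b).2, i.1), ?_⟩, ?_, ?_⟩
  · obtain ⟨⟨s, a, i⟩, h⟩ := p
    obtain ⟨h1, h2⟩ := (augStep_iff ..).mp h
    rw [← h1]
    exact Finset.mem_filter.mpr h2
  · exact (augStep_iff ..).mpr ⟨rfl, Finset.mem_filter.mp i.2⟩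
  · rintro ⟨⟨s, a, i⟩, h⟩
    have h1 := ((augStep_iff ..).mp h).1
    simp [← h1]
  · exact fun i => rfl

theorem fiber_eq_sdiff (e : S ≃ Fin (Fintype.card S)) {x : AugState S A} {b : A}
    {c₀ c₁ : AugState S A} (hc : ∀ s' ∈ leaves e x, child e x b s' = c₀ ∨ child e x b s' = c₁)
    (hne : c₀ ≠ c₁) : fiber e x b c₁ = leaves e x \ fiber e x b c₀ := by
  ext s'
  simp only [fiber, Finset.mem_filter, Finset.mem_sdiff, not_and]
  constructor
  · rintro ⟨h1, h2⟩
    exact ⟨h1, fun _ h => hne (h.symm.trans h2)⟩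
  · rintro ⟨h1, h2⟩
    exact ⟨h1, (hc s' h1).resolve_left (h2 h1)⟩

variable [Fintype A]

theorem sum_augCount (e : S ≃ Fin (Fintype.card S)) {n₀ : ℕ} (D : Dataset S A n₀)
    (x : AugState S A) (b : A) :
    ∑ x', augCount e D x b x' = hits (leaves e x) (D (treeOf x b).1 (treeOf x b).2) := by
  simp_rw [augCount_eq_hits, hits]
  rw [Finset.sum_comm]
  refine Finset.sum_congr rfl fun i _ => ?_
  simp only [fiber, Finset.mem_filter, ite_and]
  split_ifs <;> simp

theorem empirical_augCount (e : S ≃ Fin (Fintype.card S)) {n₀ : ℕ} (D : Dataset S A n₀)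
    (x : AugState S A) (b : A) (x' : AugState S A)
    (h : hits (leaves e x) (D (treeOf x b).1 (treeOf x b).2) ≠ 0) :
    empirical (augCount e D) x b x' = (augCount e D x b x' : ℝ) /
      hits (leaves e x) (D (treeOf x b).1 (treeOf x b).2) := by
  rw [empirical, ← Nat.cast_sum, sum_augCount, max_eq_right]
  exact_mod_cast Nat.one_le_iff_ne_zero.mpr h

variable {e : S ≃ Fin (Fintype.card S)} {P : TransitionKernel S A}
  {Q : TransitionKernel (AugState S A) A} {n₀ : ℕ} {D : Dataset S A n₀}
  {c : AugState S A → A → AugState S A × AugState S A} {δ : ℝ}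

/-- For typical counts, the true dynamics belong to the optimistic set. -/
theorem mem_optimisticSet_of_goodCounts (hQ : IsAugKernel e P Q)
    (hc : ∀ x b, ∀ s' ∈ leaves e x, child e x b s' = (c x b).1 ∨ child e x b s' = (c x b).2)
    (hδ0 : 0 < δ) (hδ1 : δ ≤ 1)
    (hD : ∀ x b, GoodCounts (leaves e x) (fiber e x b (c x b).1) (Q x b (c x b).1)
      (reach e P x b) (Real.log (4 / δ)) (Real.log (2 / δ)) (D (treeOf x b).1 (treeOf x b).2)) :
    Q ∈ optimisticSet (augSupp e) (augCount e D) δ := by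
  have hL : 0 ≤ Real.log (4 / δ) := Real.log_nonneg (by rw [le_div_iff₀ hδ0]; linarith)
  have hL₂ : 0 ≤ Real.log (2 / δ) := Real.log_nonneg (by rw [le_div_iff₀ hδ0]; linarith)
  refine ⟨hQ.1, fun x b x' hN => ?_⟩
  set ω := D (treeOf x b).1 (treeOf x b).2 with hω
  have hx' : augCount e D x b x' = hits (fiber e x b x') ω := augCount_eq_hits ..
  have hsd := hits_sdiff (Finset.filter_subset (fun s' => child e x b s' = x') (leaves e x)) ω
  have hkn : hits (fiber e x b x') ω ≤ hits (leaves e x) ω := by rw [← hsd]; exact le_add_self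
  have hk : hits (fiber e x b x') ω ≠ 0 := hx' ▸ hN
  obtain ⟨g1, g2, -⟩ := hD x b
  have key : ∀ p : ℝ, p = Q x b x' → p * (1 - p) = Q x b (c x b).1 * (1 - Q x b (c x b).1) →
      |(hits (fiber e x b x') ω : ℝ) - p * hits (leaves e x) ω| =
        |(hits (fiber e x b (c x b).1) ω : ℝ) - Q x b (c x b).1 * hits (leaves e x) ω| →
      |Q x b x' - empirical (augCount e D) x b x'| ≤ radius (augCount e D) δ x b x' := by
    rintro p rfl hv ha
    rw [radius, empirical_augCount e D x b x' (by rw [← hω]; omega), hx', ← hω]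
    refine le_radius_of_count (stdSimplex.zero_le _ _) (stdSimplex.le_one _ _) hL hL₂ hk hkn ?_ ?_
    · rw [ha, hv]; exact g1
    · rw [ha]; exact g2
  by_cases h0 : x' = (c x b).1
  · subst h0
    exact key _ rfl rfl rfl
  · have h1 : x' = (c x b).2 := by
      by_contra h1
      refine hk ?_
      have : fiber e x b x' = ∅ := by
        rw [fiber, Finset.filter_eq_empty_iff]
        rintro s' hs' rfl
        rcases hc x b s' hs' with h | h
        · exact h0 h
        · exact h1 h
      simp [this, hits]
    subst h1
    have hQ1 := apply_eq_of_two_point (Q x b) (apply_eq_zero_of_children hQ.1 (hc x b)) (Ne.symm h0)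
    have hsum := hits_sdiff (Finset.filter_subset (fun s' => child e x b s' = (c x b).1)
      (leaves e x)) ω
    have hf := fiber_eq_sdiff e (hc x b) (Ne.symm h0)
    have hsum' : (hits (fiber e x b (c x b).2) ω : ℝ) + hits (fiber e x b (c x b).1) ω =
        hits (leaves e x) ω := by rw [hf]; exact_mod_cast hsum
    refine key _ rfl (by rw [hQ1]; ring) ?_
    rw [hQ1, ← abs_neg]
    congr 1
    linarith

/-- For typical counts, every kernel in the optimistic set is close to the true dynamics at each
vertex, at the rate of the number of samples that are expected to reach this vertex. -/
theorem abs_sub_le_of_goodCounts (hQ : IsAugKernel e P Q)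
    (hc : ∀ x b, ∀ s' ∈ leaves e x, child e x b s' = (c x b).1 ∨ child e x b s' = (c x b).2)
    (hδ0 : 0 < δ) (hδ1 : δ ≤ 1)
    (hD : ∀ x b, GoodCounts (leaves e x) (fiber e x b (c x b).1) (Q x b (c x b).1)
      (reach e P x b) (Real.log (4 / δ)) (Real.log (2 / δ)) (D (treeOf x b).1 (treeOf x b).2))
    {P' : TransitionKernel (AugState S A) A}
    (hP' : P' ∈ optimisticSet (augSupp e) (augCount e D) δ) (hn₀ : 0 < n₀) {x : AugState S A}
    {b : A} (hR : 0 < reach e P x b) :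
    |P' x b (c x b).1 - Q x b (c x b).1| ≤
      4 * √(Q x b (c x b).1 * (1 - Q x b (c x b).1) *
        (2 * Real.log (4 / δ) / (n₀ * reach e P x b))) +
      11 * (2 * Real.log (4 / δ) / (n₀ * reach e P x b)) := by
  have hL : 0 < Real.log (4 / δ) := Real.log_pos (by rw [lt_div_iff₀ hδ0]; linarith)
  set L := Real.log (4 / δ) with hLdef
  have hnR : 0 < n₀ * reach e P x b := by positivity
  set p := Q x b (c x b).1 with hp
  set p' := P' x b (c x b).1 with hp'
  have hp0 : 0 ≤ p := stdSimplex.zero_le _ _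
  have hp1 : p ≤ 1 := stdSimplex.le_one _ _
  have hp'0 : 0 ≤ p' := stdSimplex.zero_le _ _
  have hp'1 : p' ≤ 1 := stdSimplex.le_one _ _
  set ρ := 2 * L / (n₀ * reach e P x b) with hρ
  have hρ0 : 0 ≤ ρ := by positivity
  have hs0 : 0 ≤ √(p * (1 - p) * ρ) := Real.sqrt_nonneg _
  obtain ⟨g1, -, g3⟩ := hD x b
  set ω := D (treeOf x b).1 (treeOf x b).2 with hω
  -- at a rarely visited vertex the claim is void
  by_cases h8 : 8 * L < n₀ * reach e P x b
  swap
  · have h1 : 1 / 4 ≤ ρ := by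
      rw [hρ, le_div_iff₀ hnR]; linarith
    have h2 : |p' - p| ≤ 1 := abs_le.mpr ⟨by linarith, by linarith⟩
    linarith
  have hN := g3 h8
  set N := hits (leaves e x) ω with hNdef
  have hNpos : (0 : ℝ) < N := by linarith
  have hN0 : N ≠ 0 := by rintro h; simp [h] at hNpos
  have hLN : L / N ≤ ρ := by
    rw [hρ, div_le_div_iff₀ hNpos hnR]; nlinarith
  by_cases hne : (c x b).1 = (c x b).2
  · -- the only child has probability one
    have h1 : ∀ K : TransitionKernel (AugState S A) A,
        (∀ x b x', x' ∉ augSupp e x b → K x b x' = 0) → K x b (c x b).1 = 1 := fun K hK => by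
      rw [← stdSimplex.sum_eq_one (K x b)]
      refine (Finset.sum_eq_single _ (fun y _ hy => ?_) (by simp)).symm
      exact apply_eq_zero_of_children hK (hc x b) y hy (hne ▸ hy)
    have h2 : p' - p = 0 := by rw [hp', hp, h1 P' hP'.1, h1 Q hQ.1, sub_self]
    rw [h2, abs_zero]
    linarith
  set k := hits (fiber e x b (c x b).1) ω with hk
  have hsum : hits (leaves e x \ fiber e x b (c x b).1) ω + k = N :=
    hits_sdiff (Finset.filter_subset _ _) ω
  have hk1 : augCount e D x b (c x b).1 = k := augCount_eq_hits ..
  have hk2 : augCount e D x b (c x b).2 = N - k := by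
    rw [augCount_eq_hits, ← hω, fiber_eq_sdiff e (hc x b) hne]; omega
  have hkN : k ≤ N := by omega
  have hE1 : empirical (augCount e D) x b (c x b).1 = (k : ℝ) / N := by
    rw [empirical_augCount e D x b _ hN0, hk1]
  have hE2 : empirical (augCount e D) x b (c x b).2 = 1 - (k : ℝ) / N := by
    rw [empirical_augCount e D x b _ hN0, hk2, Nat.cast_sub hkN, ← hω, ← hNdef]
    field_simp
  have hP1 : P' x b (c x b).2 = 1 - p' :=
    apply_eq_of_two_point (P' x b) (apply_eq_zero_of_children hP'.1 (hc x b)) hne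
  have hmain := abs_sub_le_of_radius (p := p) (p' := p') (n := N) (k := k) hp0 hp1 hL.le hN0 hkN g1
    (fun h => by
      have h1 := (hP'.2 x b (c x b).1 (by rw [hk1]; exact h)).trans (min_le_left _ _)
      rw [hE1, hk1] at h1
      exact h1)
    (fun h => by
      have h1 := (hP'.2 x b (c x b).2 (by rw [hk2]; exact h)).trans (min_le_left _ _)
      rw [hE2, hk2, hP1, abs_sub_comm, sub_sub_sub_cancel_left] at h1
      refine h1.trans (le_of_eq ?_)
      rw [sub_sub_cancel]
      congr 2
      ring)
  refine hmain.trans (add_le_add (mul_le_mul_of_nonneg_left (Real.sqrt_le_sqrt ?_) (by norm_num))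
    (by linarith))
  exact mul_le_mul_of_nonneg_left hLN (mul_nonneg hp0 (by linarith))

end AugCounts

section Rates

variable {S A : Type*} [Fintype S] [Fintype A] {m : ℕ}

theorem reach_pos_of_augFlow_ne_zero (M : SICMDP S A m) (e : S ≃ Fin (Fintype.card S))
    (P : TransitionKernel S A) (π : StationaryPolicy S A) (ν : S → ℝ) {x : AugState S A}
    (h : augFlow M e P π ν x ≠ 0) (b : A) : 0 < reach e P x b := by
  rcases x with s | ⟨s, a, q⟩
  · rw [reach_inl]; exact one_pos
  · exact lt_of_le_of_ne (reach_nonneg _ _ _ _) (Ne.symm (right_ne_zero_of_mul h))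

/-- The average of the rate `C / reach`: a vertex is visited at most `reach` times as often as the
root of its tree, so that each of the fewer than `2|S|` vertices of a tree contributes at most as
much as its root. -/
theorem sum_augFlow_div_reach_le [Nonempty S] (M : SICMDP S A m) (e : S ≃ Fin (Fintype.card S))
    (P : TransitionKernel S A) (π : StationaryPolicy (AugState S A) A) {ν : S → ℝ}
    (hν0 : ∀ s, 0 ≤ ν s) {C : ℝ} (hC : 0 ≤ C) :
    ∑ x, ∑ b, augFlow M e P (fun s => π (Sum.inl s)) ν x * π x b * (C / reach e P x b) ≤
      C * (2 * Fintype.card S * ∑ s, ν s) := by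
  have hγ0 := M.augment.γ_nonneg
  have hγ1 := M.augment.γ_lt_one.le
  have hnode : ∀ s a q, ∑ b, augFlow M e P (fun s => π (Sum.inl s)) ν (Sum.inr (s, a, q)) *
      π (Sum.inr (s, a, q)) b * (C / reach e P (Sum.inr (s, a, q)) b) ≤
      C * (ν s * π (Sum.inl s) a) := by
    intro s a q
    have hω : 0 ≤ ν s * π (Sum.inl s) a := mul_nonneg (hν0 s) (stdSimplex.zero_le _ _)
    have hle : ∀ b, augFlow M e P (fun s => π (Sum.inl s)) ν (Sum.inr (s, a, q)) *
        (C / reach e P (Sum.inr (s, a, q)) b) ≤ C * (ν s * π (Sum.inl s) a) := by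
      intro b
      have hr : reach e P (Sum.inr (s, a, q)) b = reach e P (Sum.inr (s, a, q)) a := rfl
      rw [augFlow, hr]
      set R := reach e P (Sum.inr (s, a, q)) a
      have h1 : R * (C / R) ≤ C := by
        by_cases hR : R = 0
        · simp [hR, hC]
        · rw [mul_div_cancel₀ _ hR]
      have h2 : M.augment.γ ^ (q.1.1 : ℕ) ≤ 1 := pow_le_one₀ hγ0 hγ1
      calc M.augment.γ ^ (q.1.1 : ℕ) * (ν s * π (Sum.inl s) a) * R * (C / R)
          = M.augment.γ ^ (q.1.1 : ℕ) * (ν s * π (Sum.inl s) a) * (R * (C / R)) := by ring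
        _ ≤ 1 * (ν s * π (Sum.inl s) a) * C := by
            refine mul_le_mul (mul_le_mul_of_nonneg_right h2 hω) h1 ?_ (by linarith)
            have := reach_nonneg e P (Sum.inr (s, a, q)) a
            positivity
        _ = _ := by ring
    calc _ ≤ ∑ b, π (Sum.inr (s, a, q)) b * (C * (ν s * π (Sum.inl s) a)) :=
          Finset.sum_le_sum fun b _ => by
            have := mul_le_mul_of_nonneg_left (hle b)
              (stdSimplex.zero_le (π (Sum.inr (s, a, q))) b)
            linarith
      _ = _ := by rw [← Finset.sum_mul, stdSimplex.sum_eq_one, one_mul]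
  have hsum : ∑ s, ∑ a, C * (ν s * π (Sum.inl s) a) = C * ∑ s, ν s := by
    rw [← sum_weight_policy (fun s => π (Sum.inl s)) ν]
    simp_rw [Finset.mul_sum]
  have hν : 0 ≤ ∑ s, ν s := Finset.sum_nonneg fun s _ => hν0 s
  rw [Fintype.sum_sum_type]
  have h1 : ∑ s, ∑ b, augFlow M e P (fun s => π (Sum.inl s)) ν (Sum.inl s) * π (Sum.inl s) b *
      (C / reach e P (Sum.inl s) b) = C * ∑ s, ν s := by
    rw [← hsum]
    refine Finset.sum_congr rfl fun s _ => Finset.sum_congr rfl fun a _ => ?_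
    rw [reach_inl, augFlow]; ring
  have h2 : ∑ y : S × A × TreeNode S, ∑ b,
      augFlow M e P (fun s => π (Sum.inl s)) ν (Sum.inr y) * π (Sum.inr y) b *
      (C / reach e P (Sum.inr y) b) ≤ Fintype.card (TreeNode S) * (C * ∑ s, ν s) := by
    rw [Fintype.sum_prod_type, ← hsum, Finset.mul_sum]
    refine Finset.sum_le_sum fun s _ => ?_
    rw [Fintype.sum_prod_type, Finset.mul_sum]
    refine Finset.sum_le_sum fun a _ => ?_
    calc _ ≤ ∑ _q : TreeNode S, C * (ν s * π (Sum.inl s) a) :=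
          Finset.sum_le_sum fun q _ => hnode s a q
      _ = _ := by rw [Finset.sum_const, Finset.card_univ, nsmul_eq_mul]
  have h3 : (Fintype.card (TreeNode S) : ℝ) + 2 ≤ 2 * Fintype.card S := by
    exact_mod_cast card_treeNode_le S
  have h4 : 0 ≤ C * ∑ s, ν s := mul_nonneg hC hν
  rw [h1]
  nlinarith

end Rates

/-! ### The accuracy of optimistic planning -/

section Accuracy

variable {S A : Type*} [Fintype S]

theorem eq_of_subsingleton {X : Type*} [Fintype X] [Subsingleton X]
    (K K' : TransitionKernel X A) : K = K' := by
  funext x b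
  refine stdSimplex.ext (funext fun y => ?_)
  have h1 := stdSimplex.sum_eq_one (K x b)
  have h2 := stdSimplex.sum_eq_one (K' x b)
  rw [Fintype.sum_subsingleton _ y] at h1 h2
  rw [h1, h2]

/-- With a single state the trees have no inner nodes, and there is nothing to estimate. -/
theorem subsingleton_augState (hS : Fintype.card S ≤ 1) : Subsingleton (AugState S A) := by
  have h1 : Subsingleton S := Fintype.card_le_one_iff_subsingleton.mp hS
  refine ⟨?_⟩
  have h2 : TreeNode S → False := fun q => by
    have hs : Fintype.card S = 1 := by have := q.1.2.2; omega
    have h3 : treeDepth S = 1 := by simp [treeDepth, hs]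
    have := q.2.1
    have := q.1.1.2
    omega
  rintro (s | ⟨s, a, q⟩) (s' | ⟨s', a', q'⟩)
  · rw [Subsingleton.elim s s']
  · exact (h2 q').elim
  · exact (h2 q).elim
  · exact (h2 q).elim

variable [Fintype A] {m : ℕ}

theorem nonempty_of_stdSimplex {T : Type*} [Fintype T] (p : stdSimplex ℝ T) : Nonempty T := by
  by_contra h
  rw [not_nonempty_iff] at h
  have := stdSimplex.sum_eq_one p
  simp at this

/-- The effective horizon of the augmented problem; by Bernoulli's inequality, it is at most `d`
times the original one. -/
theorem horizon_augment_le (M : SICMDP S A m) :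
    1 / (1 - M.augment.γ) ≤ treeDepth S / (1 - M.γ) := by
  have h1 := one_add_mul_le_pow (a := M.augment.γ - 1) (by linarith [M.augment.γ_nonneg])
    (treeDepth S)
  rw [add_sub_cancel, M.augment_γ_pow] at h1
  rw [div_le_div_iff₀ (by linarith [M.augment.γ_lt_one]) (by linarith [M.γ_lt_one])]
  linarith

theorem treeDepth_le_log (hS : 1 < Fintype.card S) :
    (treeDepth S : ℝ) ≤ 3 * Real.log (Fintype.card S) := by
  have hne : Nonempty S := Fintype.card_pos_iff.mp (by omega)
  have h1 : ((2 : ℝ) ^ treeDepth S) ≤ 2 * Fintype.card S := by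
    exact_mod_cast two_pow_treeDepth_le S
  have hS' : (2 : ℝ) ≤ Fintype.card S := by exact_mod_cast hS
  have h2 := Real.log_le_log (by positivity) h1
  rw [Real.log_pow, Real.log_mul (by norm_num) (by positivity)] at h2
  have h3 := Real.log_le_log (by norm_num) hS'
  have h4 := Real.log_two_gt_d9
  nlinarith

/-- The number of confidence intervals that are needed in the augmented problem. -/
theorem card_augState_mul_le [Nonempty S] [Nonempty A] :
    Fintype.card (AugState S A × A) ≤ Fintype.card S ^ 3 * Fintype.card A ^ 2 := by
  have h1 := card_treeNode_le S
  have hS : 0 < Fintype.card S := Fintype.card_pos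
  have hA : 0 < Fintype.card A := Fintype.card_pos
  rw [Fintype.card_prod, Fintype.card_sum, Fintype.card_prod, Fintype.card_prod]
  set s := Fintype.card S
  set a := Fintype.card A
  set t := Fintype.card (TreeNode S)
  have h2 : 1 + a * t ≤ a * s ^ 2 := by
    have h3 : t + 1 ≤ s ^ 2 := by zify at *; nlinarith [sq_nonneg ((s : ℤ) - 1)]
    calc 1 + a * t ≤ a * (t + 1) := by linarith
      _ ≤ a * s ^ 2 := Nat.mul_le_mul_left a h3
  calc (s + s * (a * t)) * a = s * a * (1 + a * t) := by ring
    _ ≤ s * a * (a * s ^ 2) := Nat.mul_le_mul_left _ h2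
    _ = _ := by ring

variable [DecidableEq S] [DecidableEq A]

/-- For typical counts, all kernels in the optimistic set assign nearly the true value to all
policies. -/
theorem abs_value_augment_sub_le (M : SICMDP S A m) {e : S ≃ Fin (Fintype.card S)}
    {P : TransitionKernel S A} {Q : TransitionKernel (AugState S A) A} {n₀ : ℕ}
    {D : Dataset S A n₀} {c : AugState S A → A → AugState S A × AugState S A} {δ ε : ℝ}
    (hQ : IsAugKernel e P Q)
    (hc : ∀ x b, ∀ s' ∈ leaves e x, child e x b s' = (c x b).1 ∨ child e x b s' = (c x b).2)
    (hδ0 : 0 < δ) (hδ1 : δ ≤ 1) (hε : 0 < ε) (hε1 : ε * (1 - M.γ) ≤ 1)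
    (hD : ∀ x b, GoodCounts (leaves e x) (fiber e x b (c x b).1) (Q x b (c x b).1)
      (reach e P x b) (Real.log (4 / δ)) (Real.log (2 / δ)) (D (treeOf x b).1 (treeOf x b).2))
    {P' : TransitionKernel (AugState S A) A}
    (hP' : P' ∈ optimisticSet (augSupp e) (augCount e D) δ)
    (hn : 221184 * (Fintype.card S * Real.log (Fintype.card S) ^ 3 * Real.log (4 / δ) /
      (ε ^ 2 * (1 - M.γ) ^ 3)) ≤ n₀)
    (π : StationaryPolicy (AugState S A) A) {f : S → A → ℝ}
    (hf : ∀ s a, f s a ∈ Icc (0 : ℝ) 1) :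
    |M.augment.value P' π (fun x a => Sum.elim (fun s => f s a) (fun _ => 0) x) -
      M.value P (fun s => π (Sum.inl s)) f| ≤ ε := by
  have hSne : Nonempty S := nonempty_of_stdSimplex M.μ
  rw [← value_augment M e hQ π hf]
  rcases le_or_gt (Fintype.card S) 1 with hS | hS
  · have := subsingleton_augState (A := A) hS
    rw [eq_of_subsingleton P' Q, sub_self, abs_zero]
    exact hε.le
  have hγ : 0 < 1 - M.γ := by linarith [M.γ_lt_one]
  have hγ' : 0 < 1 - M.augment.γ := by linarith [M.augment.γ_lt_one]
  have hL : 0 < Real.log (4 / δ) := Real.log_pos (by rw [lt_div_iff₀ hδ0]; linarith)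
  have hS2 : (2 : ℝ) ≤ Fintype.card S := by exact_mod_cast hS
  have hd := treeDepth_le_log hS
  have hB := M.horizon_augment_le
  have hd1 : (1 : ℝ) ≤ treeDepth S := by exact_mod_cast treeDepth_pos S
  set L := Real.log (4 / δ) with hLdef
  set s : ℝ := ((Fintype.card S : ℕ) : ℝ) with hs
  set Λ := Real.log s with hΛ
  set d : ℝ := ((treeDepth S : ℕ) : ℝ) with hddef
  set B := 1 / (1 - M.augment.γ) with hBdef
  have hB0 : 0 < B := by positivity
  have hΛ0 : 0 < Λ := Real.log_pos (by linarith)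
  have hn0 : (0 : ℝ) < n₀ := lt_of_lt_of_le (by positivity) hn
  have hn0' : 0 < n₀ := by exact_mod_cast hn0
  -- the average rate is of order `ε² (1 - γ)² / d³`
  have hrate : s * L / n₀ ≤ ε ^ 2 * (1 - M.γ) ^ 3 * 27 / (221184 * d ^ 3) := by
    rw [div_le_div_iff₀ hn0 (by positivity)]
    have h1 : d ^ 3 ≤ 27 * Λ ^ 3 := by
      calc d ^ 3 ≤ (3 * Λ) ^ 3 := pow_le_pow_left₀ (by linarith) hd 3
        _ = 27 * Λ ^ 3 := by ring
    have h2 : 221184 * (s * Λ ^ 3 * L) ≤ n₀ * (ε ^ 2 * (1 - M.γ) ^ 3) := by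
      rw [← mul_div_assoc, div_le_iff₀ (by positivity)] at hn
      exact hn
    calc s * L * (221184 * d ^ 3) ≤ s * L * (221184 * (27 * Λ ^ 3)) := by gcongr
      _ = 27 * (221184 * (s * Λ ^ 3 * L)) := by ring
      _ ≤ 27 * (n₀ * (ε ^ 2 * (1 - M.γ) ^ 3)) := by linarith
      _ = _ := by ring
  set ν := M.occupancy P (fun s => π (Sum.inl s)) with hν
  have hνflow : M.IsFlow P (fun s => π (Sum.inl s)) ν := M.isFlow_occupancy P _
  have hν0 : ∀ s, 0 ≤ ν s := M.occupancy_nonneg P _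
  set ρ : AugState S A → A → ℝ := fun x b => 2 * L / n₀ / reach e P x b with hρ
  have hρ0 : ∀ x b, 0 ≤ ρ x b := fun x b => div_nonneg (by positivity) (reach_nonneg e P x b)
  set Ξ := ∑ x, ∑ b, augFlow M e P (fun s => π (Sum.inl s)) ν x * π x b * ρ x b with hΞ
  have hΞle : Ξ ≤ ε ^ 2 * (1 - M.γ) ^ 2 / (2048 * d ^ 3) := by
    have h1 := sum_augFlow_div_reach_le M e P π hν0 (C := 2 * L / n₀) (by positivity)
    rw [hνflow.sum_eq] at h1
    calc Ξ ≤ 2 * L / n₀ * (2 * s * (1 / (1 - M.γ))) := h1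
      _ = 4 / (1 - M.γ) * (s * L / n₀) := by ring
      _ ≤ 4 / (1 - M.γ) * (ε ^ 2 * (1 - M.γ) ^ 3 * 27 / (221184 * d ^ 3)) :=
          mul_le_mul_of_nonneg_left hrate (by positivity)
      _ = _ := by field_simp; norm_num
  have hBΞ : ∀ k : ℕ, B ^ k * Ξ ≤ (d / (1 - M.γ)) ^ k *
      (ε ^ 2 * (1 - M.γ) ^ 2 / (2048 * d ^ 3)) := fun k =>
    (mul_le_mul_of_nonneg_left hΞle (by positivity)).trans
      (mul_le_mul_of_nonneg_right (pow_le_pow_left₀ hB0.le hB k) (by positivity))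
  refine M.augment.abs_value_sub_le (augFlow_nonneg M e P _ hν0) (isFlow_augFlow M e hQ π hνflow)
    (fun x a => ?_) hρ0 (fun x b hx v hv => ?_) hε ?_ ?_
  · rcases x with s | z
    · exact hf s a
    · simp
  · have hR := reach_pos_of_augFlow_ne_zero M e P _ ν hx b
    refine abs_sum_sub_le_of_two_point (apply_eq_zero_of_children hQ.1 (hc x b))
      (apply_eq_zero_of_children hP'.1 (hc x b)) (hρ0 x b) ?_ hv
    simp only [hρ, div_div]
    exact abs_sub_le_of_goodCounts hQ hc hδ0 hδ1 hD hP' hn0' hR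
  · have h1 := hBΞ 1
    rw [pow_one, pow_one] at h1
    refine h1.trans ?_
    have e1 : d / (1 - M.γ) * (ε ^ 2 * (1 - M.γ) ^ 2 / (2048 * d ^ 3)) =
        ε * (ε * (1 - M.γ)) / (2048 * d ^ 2) := by field_simp
    rw [e1, div_le_div_iff₀ (by positivity) (by norm_num)]
    have h2 : 1 ≤ d ^ 2 := one_le_pow₀ hd1
    have h3 : ε * (ε * (1 - M.γ)) ≤ ε * d ^ 2 :=
      mul_le_mul_of_nonneg_left (hε1.trans h2) hε.le
    linarith
  · refine (hBΞ 2).trans ?_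
    have e1 : (d / (1 - M.γ)) ^ 2 * (ε ^ 2 * (1 - M.γ) ^ 2 / (2048 * d ^ 3)) =
        ε ^ 2 / (2048 * d) := by field_simp
    rw [e1]
    refine div_le_div_of_nonneg_left (by positivity) (by norm_num) (by linarith)

/-- The counts are typical, at all vertices simultaneously, with probability at least `1 - δ`. -/
theorem sum_iidProb_not_goodCounts_le [Nonempty S] [Nonempty A] {e : S ≃ Fin (Fintype.card S)}
    {P : TransitionKernel S A} {Q : TransitionKernel (AugState S A) A} (n₀ : ℕ)
    (c : AugState S A → A → AugState S A × AugState S A) {δ δ' : ℝ} (hQ : IsAugKernel e P Q)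
    (hδ0 : 0 < δ) (hδ1 : δ ≤ 1)
    (hδ' : δ' = δ / (2 * (Fintype.card S : ℝ) ^ 4 * (Fintype.card A : ℝ) ^ 3)) :
    ∑ z : AugState S A × A, iidProb (fun s' => P (treeOf z.1 z.2).1 (treeOf z.1 z.2).2 s') n₀
      (fun ω => ¬ GoodCounts (leaves e z.1) (fiber e z.1 z.2 (c z.1 z.2).1)
        (Q z.1 z.2 (c z.1 z.2).1) (reach e P z.1 z.2) (Real.log (4 / δ')) (Real.log (2 / δ')) ω)
      ≤ δ := by
  have hS : (1 : ℝ) ≤ Fintype.card S := by exact_mod_cast Fintype.card_pos (α := S)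
  have hA : (1 : ℝ) ≤ Fintype.card A := by exact_mod_cast Fintype.card_pos (α := A)
  have hcard : (Fintype.card (AugState S A × A) : ℝ) ≤
      (Fintype.card S : ℝ) ^ 3 * (Fintype.card A : ℝ) ^ 2 := by
    exact_mod_cast card_augState_mul_le (S := S) (A := A)
  have hpow : 1 ≤ (Fintype.card S : ℝ) ^ 4 * (Fintype.card A : ℝ) ^ 3 :=
    one_le_mul_of_one_le_of_one_le (one_le_pow₀ hS) (one_le_pow₀ hA)
  have hδ'0 : 0 < δ' := by rw [hδ']; positivity
  have hδ'1 : δ' ≤ 1 := by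
    rw [hδ', div_le_one (by positivity)]; linarith
  have hL : 0 < Real.log (4 / δ') := Real.log_pos (by rw [lt_div_iff₀ hδ'0]; linarith)
  have hL₂ : 0 < Real.log (2 / δ') := Real.log_pos (by rw [lt_div_iff₀ hδ'0]; linarith)
  calc _ ≤ ∑ _z : AugState S A × A, 2 * δ' := by
        refine Finset.sum_le_sum fun z _ => ?_
        have h := iidProb_not_goodCounts_le
          (p := fun s' => P (treeOf z.1 z.2).1 (treeOf z.1 z.2).2 s') (n := n₀)
          (fun _ => stdSimplex.zero_le _ _) (stdSimplex.sum_eq_one _)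
          (G := leaves e z.1) (H := fiber e z.1 z.2 (c z.1 z.2).1) (Finset.filter_subset _ _)
          (hQ.2 z.1 z.2 _) (stdSimplex.zero_le _ _) (stdSimplex.le_one _ _) hL hL₂
        rw [Real.exp_neg, Real.exp_neg, Real.exp_log (by positivity),
          Real.exp_log (by positivity), inv_div, inv_div] at h
        refine h.trans ?_
        linarith
    _ = Fintype.card (AugState S A × A) * (2 * δ') := by
        rw [Finset.sum_const, Finset.card_univ, nsmul_eq_mul]
    _ ≤ (Fintype.card S : ℝ) ^ 3 * (Fintype.card A : ℝ) ^ 2 * (2 * δ') :=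
        mul_le_mul_of_nonneg_right hcard (by positivity)
    _ = δ / (Fintype.card S * Fintype.card A) := by rw [hδ']; field_simp
    _ ≤ δ := div_le_self hδ0.le (one_le_mul_of_one_le_of_one_le hS hA)

end Accuracy

end SICMDP

theorem mainTheorem1 :
    ∃ C : ℝ, 0 < C ∧
      ∀ (S A : Type*) [Fintype S] [Fintype A] [DecidableEq S] [DecidableEq A] (m : ℕ)
        (M : SICMDP S A m) (P : TransitionKernel S A) (πstar : StationaryPolicy S A)
        (e : S ≃ Fin (Fintype.card S)) (ε δ : ℝ) (n₀ : ℕ)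
        (solve : SICMDP.Dataset S A n₀ →
          TransitionKernel (SICMDP.AugState S A) A × StationaryPolicy (SICMDP.AugState S A) A),
        M.IsOptimalPolicy P πstar → 0 < ε → 0 < δ →
        C * ((Fintype.card S : ℝ) ^ 2 * (Fintype.card A : ℝ) ^ 2 *
              Real.log (Fintype.card S) ^ 3 *
              Real.log (8 * (Fintype.card S : ℝ) ^ 4 * (Fintype.card A : ℝ) ^ 3 / δ) /
            (ε ^ 2 * (1 - M.γ) ^ 3))
          ≤ (Fintype.card S : ℝ) * Fintype.card A * n₀ →
        M.SolvesExactly e δ n₀ solve →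
        M.IsEpsDeltaOptimal P πstar n₀ (SICMDP.modifiedSICRL solve) ε δ := by
  -- `221184 = 2048 * 4 * 27`, where `27` stems from `d ≤ 3 log |S|` and `4` from the average rate
  refine ⟨221184, by norm_num, ?_⟩
  intro S A _ _ _ _ m M P πstar e ε δ n₀ solve hopt hε hδ hn hsolve
  have hSne : Nonempty S := SICMDP.nonempty_of_stdSimplex M.μ
  have hAne : Nonempty A := SICMDP.nonempty_of_stdSimplex (πstar hSne.some)
  have hγ : 0 < 1 - M.γ := by linarith [M.γ_lt_one]
  rw [SICMDP.IsEpsDeltaOptimal]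
  -- values lie between `0` and `1 / (1 - γ)`, hence errors above `1 / (1 - γ)` are impossible
  rcases lt_or_ge 1 (ε * (1 - M.γ)) with hε1 | hε1
  · have hB : 1 / (1 - M.γ) ≤ ε := by rw [div_le_iff₀ hγ]; exact hε1.le
    have h := SICMDP.generativeProb_ge (J := Empty) P n₀
      {D | M.value P πstar M.r - M.value P (SICMDP.modifiedSICRL solve D) M.r ≤ ε ∧
        ∀ y : M.Y, M.value P (SICMDP.modifiedSICRL solve D) (M.c y) - M.u y ≤ ε}
      (fun j => j.elim) (fun j => j.elim) (fun D hD => (hD ⟨?_, fun y => ?_⟩).elim)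
    · simp only [Finset.univ_eq_empty, Finset.sum_empty, sub_zero] at h
      linarith
    · have h1 := (M.value_mem_Icc P πstar M.r_mem).2
      have h2 := (M.value_mem_Icc P (SICMDP.modifiedSICRL solve D) M.r_mem).1
      linarith
    · have h1 := (M.value_mem_Icc P (SICMDP.modifiedSICRL solve D) (M.c_mem y)).2
      have h2 := (M.value_mem_Icc P πstar (M.c_mem y)).1
      have h3 := hopt.1 y
      linarith
  rcases lt_or_ge 1 δ with hδ1 | hδ1
  · refine le_trans (by linarith : 1 - δ ≤ 0) (Finset.sum_nonneg fun D _ => ?_)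
    exact Set.indicator_nonneg (fun D _ => Finset.prod_nonneg fun _ _ => Finset.prod_nonneg
      fun _ _ => Finset.prod_nonneg fun _ _ => stdSimplex.zero_le _ _) D
  have hS : (1 : ℝ) ≤ Fintype.card S := by exact_mod_cast Fintype.card_pos (α := S)
  have hA : (1 : ℝ) ≤ Fintype.card A := by exact_mod_cast Fintype.card_pos (α := A)
  set δ' := δ / (2 * (Fintype.card S : ℝ) ^ 4 * (Fintype.card A : ℝ) ^ 3) with hδ'
  have hδ'0 : 0 < δ' := by positivity
  have hδ'1 : δ' ≤ 1 := by
    have hpow : 1 ≤ (Fintype.card S : ℝ) ^ 4 * (Fintype.card A : ℝ) ^ 3 :=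
      one_le_mul_of_one_le_of_one_le (one_le_pow₀ hS) (one_le_pow₀ hA)
    rw [hδ', div_le_one (by positivity)]
    linarith
  have hL0 : 0 ≤ Real.log (4 / δ') := Real.log_nonneg (by rw [le_div_iff₀ hδ'0]; linarith)
  have hn' : 221184 * (Fintype.card S * Real.log (Fintype.card S) ^ 3 * Real.log (4 / δ') /
      (ε ^ 2 * (1 - M.γ) ^ 3)) ≤ n₀ := by
    have e1 : 8 * (Fintype.card S : ℝ) ^ 4 * (Fintype.card A : ℝ) ^ 3 / δ = 4 / δ' := by
      rw [hδ']; field_simp; norm_num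
    rw [e1] at hn
    have h0 : 0 ≤ 221184 * (Fintype.card S * Real.log (Fintype.card S) ^ 3 * Real.log (4 / δ') /
        (ε ^ 2 * (1 - M.γ) ^ 3)) := by
      have := Real.log_nonneg hS
      positivity
    refine (le_mul_of_one_le_right h0 hA).trans ?_
    refine le_of_mul_le_mul_left (hn.trans_eq' ?_)
      (by positivity : (0 : ℝ) < Fintype.card S * Fintype.card A)
    ring
  obtain ⟨Q, hQ⟩ := SICMDP.exists_isAugKernel e P
  choose c₀ c₁ hc using fun (x : SICMDP.AugState S A) (b : A) =>
    SICMDP.exists_two_children e x b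
  have hprob := SICMDP.sum_iidProb_not_goodCounts_le n₀ (fun x b => (c₀ x b, c₁ x b)) hQ hδ hδ1 hδ'
  refine le_trans (sub_le_sub_left hprob 1) (SICMDP.generativeProb_ge P n₀ _
    (fun z : SICMDP.AugState S A × A => SICMDP.treeOf z.1 z.2) _ fun D hD => ?_)
  by_contra hgood
  push Not at hgood
  refine hD ?_
  have hgood' := fun x b => hgood (x, b)
  have hmem := SICMDP.mem_optimisticSet_of_goodCounts (c := fun x b => (c₀ x b, c₁ x b))
    hQ hc hδ'0 hδ'1 hgood'
  have hacc := fun {P'} hP' π {f} hf => SICMDP.abs_value_augment_sub_le M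
    (c := fun x b => (c₀ x b, c₁ x b)) hQ hc hδ'0 hδ'1 hε hε1 hgood' (P' := P') hP' hn' π
    (f := f) hf
  -- the optimal policy, with arbitrary actions in the trees, is feasible for the true dynamics
  set πbar : StationaryPolicy (SICMDP.AugState S A) A :=
    Sum.elim πstar (fun z => πstar z.1) with hπbar
  have hval : ∀ {f : S → A → ℝ}, (∀ s a, f s a ∈ Icc (0 : ℝ) 1) →
      M.augment.value Q πbar (fun x a => Sum.elim (fun s => f s a) (fun _ => 0) x) =
        M.value P πstar f := fun hf => SICMDP.value_augment M e hQ πbar hf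
  have hfeas : M.augment.Feasible Q πbar := fun y =>
    (hval (M.c_mem y)).trans_le (hopt.1 y)
  obtain ⟨hz1, hz2, hz3⟩ := hsolve D (M.augment.exists_isOptimisticSolution
    (SICMDP.isClosed_optimisticSet _ _ _) hmem hfeas)
  refine ⟨?_, fun y => ?_⟩
  · have h1 := (hval M.r_mem).symm.trans_le (hz3 Q hmem πbar hfeas)
    have h2 := (abs_le.mp (hacc hz1 (solve D).2 M.r_mem)).2
    change M.value P πstar M.r ≤ M.augment.value (solve D).1 (solve D).2
      (fun x a => Sum.elim (fun s => M.r s a) (fun _ => 0) x) at h1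
    change _ - M.value P (fun s => (solve D).2 (Sum.inl s)) M.r ≤ ε
    linarith
  · have h1 := hz2 y
    have h2 := (abs_le.mp (hacc hz1 (solve D).2 (M.c_mem y))).1
    change M.augment.value (solve D).1 (solve D).2
      (fun x a => Sum.elim (fun s => M.c y s a) (fun _ => 0) x) ≤ M.u y at h1
    change M.value P (fun s => (solve D).2 (Sum.inl s)) (M.c y) - M.u y ≤ ε
    linarith
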